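/- Let $\mathcal S^d$ be the real vector space of symmetric real $d\times d$ matrices, regarded as quadratic forms $Q[x]=x^tQx$, and let $\mathcal S^d_{>0}$ be the cone of positive definite forms (PQFs). For a PQF $Q$ let $$\mu(Q)=\max_{x\in\mathbb R^d}\ \min_{v\in\mathbb Z^d} Q[x-v],\qquad \Theta(Q)=\sqrt{\frac{\mu(Q)^d}{\det Q}}\cdot\kappa_d$$ be its inhomogeneous minimum and its covering density, where $\kappa_d$ is the volume of the $d$-dimensional Euclidean unit ball. A Delone polytope of $Q$ is the convex hull of a nonempty finite set $V\subset\mathbb Z^d$ for which there are $c\in\mathbb R^d$ and $r\in\mathbb R$ with $Q[v-c]=r^2$ for all $v\in V$ and $Q[v-c]>r^2$ for all $v\in\mathbb Z^d\setminus V$; the Delone subdivision $\mathrm{Del}(Q)$ is the set of all Delone polytopes of $Q$, and the secondary cone of $Q$ is $\{Q'\in\mathcal S^d_{>0}:\mathrm{Del}(Q')=\mathrm{Del}(Q)\}$. A PQF is a locally optimal solution to the lattice covering problem if it is a local minimum of $\Theta$ on $\mathcal S^d_{>0}$. **Theorem.** The symmetric integral matrix $$Q^c_7=\begin{pmatrix}12&1&1&1&1&1&5\\1&12&1&1&1&1&5\\1&1&12&1&1&1&5\\1&1&1&12&1&1&5\\1&1&1&1&12&1&5\\1&1&1&1&1&12&-6\\5&5&5&5&5&-6&14\end{pmatrix}$$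 is a PQF. It lies in the interior (with respect to $\mathcal S^7$) of its secondary cone and is a locally optimal solution to the lattice covering problem. Its inhomogeneous minimum is $\mu(Q^c_7)=\frac{15}{2}$ and its determinant is $\det Q^c_7=2\cdot 11^6$, so that $2.900024<\Theta(Q^c_7)<2.900025$. In particular, $\Theta(Q^c_7)$ is smaller than the covering density of the lattice $\mathsf A_7^*$, that is, of the form $7\sum_{i}x_i^2-\sum_{i\ne j}x_ix_j$. -/

import Mathlib

open MeasureTheory

namespace LatticeCovering

/-- The real vector space `S^d` of quadratic forms in `d` variables, identified with the
symmetric real `d × d` matrices. It carries the subspace topology. -/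
def quadForms (d : ℕ) : Submodule ℝ (Matrix (Fin d) (Fin d) ℝ) where
  carrier := {Q | Q.IsSymm}
  add_mem' := fun ha hb => Matrix.IsSymm.add ha hb
  zero_mem' := Matrix.isSymm_zero
  smul_mem' := fun k _ h => Matrix.IsSymm.smul h k

/-- The value `Q[x] = xᵗ Q x`. -/
def value {d : ℕ} (Q : quadForms d) (x : Fin d → ℝ) : ℝ :=
  x ⬝ᵥ ((Q : Matrix (Fin d) (Fin d) ℝ).mulVec x)

/-- An integral vector viewed as a real vector. -/
def toReal {d : ℕ} (v : Fin d → ℤ) : Fin d → ℝ := fun i => (v i : ℝ)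

/-- The cone `S^d_{>0}` of positive definite quadratic forms (PQFs). -/
def pqf (d : ℕ) : Set (quadForms d) :=
  {Q | (Q : Matrix (Fin d) (Fin d) ℝ).PosDef}

/-- The determinant of a quadratic form. -/
noncomputable def det {d : ℕ} (Q : quadForms d) : ℝ :=
  (Q : Matrix (Fin d) (Fin d) ℝ).det

/-- The inhomogeneous minimum `μ(Q) = max_{x ∈ ℝ^d} min_{v ∈ ℤ^d} Q[x - v]`. For a PQF the
values `Q[x - v]` are nonnegative, and the inner minima are bounded in `x` (by periodicity);
the infimum and the supremum are then attained. -/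
noncomputable def inhomMin {d : ℕ} (Q : quadForms d) : ℝ :=
  ⨆ x : Fin d → ℝ, ⨅ v : Fin d → ℤ, value Q (x - toReal v)

/-- The volume `κ_d` of the `d`-dimensional Euclidean unit ball. -/
noncomputable def unitBallVolume (d : ℕ) : ℝ :=
  (volume (Metric.closedBall (0 : EuclideanSpace ℝ (Fin d)) 1)).toReal

/-- The covering density `Θ(Q) = √(μ(Q)^d / det Q) · κ_d`. -/
noncomputable def coveringDensity {d : ℕ} (Q : quadForms d) : ℝ :=
  Real.sqrt (inhomMin Q ^ d / det Q) * unitBallVolume d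

/-- `Q` is a locally optimal solution to the lattice covering problem: a PQF at which the
covering density, as a function on the set of all PQFs, has a local minimum. -/
def IsLocallyOptimalCovering {d : ℕ} (Q : quadForms d) : Prop :=
  Q ∈ pqf d ∧ IsLocalMinOn coveringDensity (pqf d) Q

/-- `L ⊆ ℝ^d` is a Delone polytope of `Q`: the convex hull of a nonempty finite set `V` of
integral vectors lying on an ellipsoid `Q[x - c] = r²` such that every other integral vector
lies strictly outside this ellipsoid. -/
def IsDelonePolytope {d : ℕ} (Q : quadForms d) (L : Set (Fin d → ℝ)) : Prop :=
  ∃ V : Finset (Fin d → ℤ), V.Nonempty ∧ L = convexHull ℝ (toReal '' (V : Set (Fin d → ℤ))) ∧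
    ∃ (c : Fin d → ℝ) (r : ℝ),
      (∀ v ∈ V, value Q (toReal v - c) = r ^ 2) ∧
      (∀ v ∉ V, r ^ 2 < value Q (toReal v - c))

/-- The Delone subdivision `Del(Q)`: the set of all Delone polytopes of `Q`. -/
def deloneSubdivision {d : ℕ} (Q : quadForms d) : Set (Set (Fin d → ℝ)) :=
  {L | IsDelonePolytope Q L}

/-- The secondary cone of a Delone subdivision `D`: all PQFs with Delone subdivision `D`. -/
def secondaryCone {d : ℕ} (D : Set (Set (Fin d → ℝ))) : Set (quadForms d) :=
  {Q | Q ∈ pqf d ∧ deloneSubdivision Q = D}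

/-- Voronoi's principal form of the first type `d ∑ x_i² - ∑_{i ≠ j} x_i x_j`, a PQF of the
lattice `A_d^*`. -/
def principalForm (d : ℕ) : quadForms d :=
  ⟨Matrix.of fun i j => if i = j then (d : ℝ) else -1, by
    refine Matrix.IsSymm.ext fun i j => ?_
    simp only [Matrix.of_apply, eq_comm]⟩

/-- The integral `7 × 7` form `Q^c_7`. -/
def Qc7 : quadForms 7 :=
  ⟨!![12,  1,  1,  1,  1,  1,  5;
       1, 12,  1,  1,  1,  1,  5;
       1,  1, 12,  1,  1,  1,  5;
       1,  1,  1, 12,  1,  1,  5;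
       1,  1,  1,  1, 12,  1,  5;
       1,  1,  1,  1,  1, 12, -6;
       5,  5,  5,  5,  5, -6, 14], by
    refine Matrix.IsSymm.ext fun i j => ?_
    fin_cases i <;> fin_cases j <;> rfl⟩

end LatticeCovering

/-! In the coordinates `y = coordMatrix x` the lattice is the set of integral `y` whose entries are
congruent modulo 3, and the form is `(11 ∑ y_i² + (∑ y_i)²) / 9`. Both are invariant under all
permutations of the coordinates, so finite checks on four simplices suffice: their images under
permutations and lattice translations form the Delone triangulation.

The Delone property is certified locally. If across each facet the opposite apex lies outside the
circumsphere (`IsRegular`), then crossing a facet that separates a cell from `x` strictly lowers the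
power of `x`. Hence the cell of minimal power contains `x`; the cells cover space, and their
circumspheres contain no lattice point inside and only vertices on them. So a regular form has the
faces of the cells as its Delone polytopes. Regularity consists of finitely many strict inequalities
continuous in `Q`, which gives the interior statement.

The largest squared circumradius is 15/2, an upper bound for `μ(Qc7)`. Conversely, for every regular
PQF `Q` and fixed affine weights `β_j` of vertices `v_j` with combination `x`, Steiner's identity
gives `∑ β_j Q[v_j - x] ≤ μ(Q)`, which is linear in `Q`. Taking the barycentric coordinates of the
circumcentres for `Qc7`, averaging over permutations and mixing two of the four classes yields
`15/14 · tr(D P) ≤ μ(Q)`. Here `P` is the matrix of `Q` in the new coordinates and `D` is the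
inverse of that of `Qc7`. The AM-GM inequality `det D · det P ≤ (tr(D P)/7)^7` is an equality at
`Qc7`, so `Θ(Q) ≥ Θ(Qc7)` for all regular `Q`, hence near `Qc7`.

For the comparison with `A_7^*` a lower bound on its inhomogeneous minimum, from one explicit point,
is enough. -/

namespace LatticeCovering

open Filter Topology

/-! ### Values of quadratic forms -/

section Value

variable {d : ℕ}

/-- The symmetric bilinear form of `Q`. -/
def bilin (Q : quadForms d) (x y : Fin d → ℝ) : ℝ :=
  x ⬝ᵥ ((Q : Matrix (Fin d) (Fin d) ℝ).mulVec y)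

theorem bilin_self (Q : quadForms d) (x : Fin d → ℝ) : bilin Q x x = value Q x := rfl

theorem bilin_comm (Q : quadForms d) (x y : Fin d → ℝ) : bilin Q x y = bilin Q y x := by
  have hQ : (Q : Matrix (Fin d) (Fin d) ℝ).transpose = Q := Q.2
  unfold bilin
  rw [Matrix.dotProduct_mulVec, dotProduct_comm, ← Matrix.mulVec_transpose, hQ]

theorem bilin_add_right (Q : quadForms d) (x y z : Fin d → ℝ) :
    bilin Q x (y + z) = bilin Q x y + bilin Q x z := by
  simp [bilin, Matrix.mulVec_add, dotProduct_add]

theorem bilin_smul_right (Q : quadForms d) (x y : Fin d → ℝ) (a : ℝ) :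
    bilin Q x (a • y) = a * bilin Q x y := by
  simp [bilin, Matrix.mulVec_smul, dotProduct_smul]

/-- The bilinear form with its first argument fixed, as a linear map. -/
def bilinMap (Q : quadForms d) (x : Fin d → ℝ) : (Fin d → ℝ) →ₗ[ℝ] ℝ where
  toFun := bilin Q x
  map_add' := bilin_add_right Q x
  map_smul' a y := bilin_smul_right Q x y a

theorem bilin_sum_right (Q : quadForms d) {ι : Type*} (s : Finset ι) (x : Fin d → ℝ)
    (a : ι → ℝ) (y : ι → Fin d → ℝ) :
    bilin Q x (∑ i ∈ s, a i • y i) = ∑ i ∈ s, a i * bilin Q x (y i) := by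
  change bilinMap Q x _ = _
  rw [map_sum]
  exact Finset.sum_congr rfl fun i _ => bilin_smul_right Q x (y i) (a i)

theorem bilin_add_left (Q : quadForms d) (x y z : Fin d → ℝ) :
    bilin Q (x + y) z = bilin Q x z + bilin Q y z := by
  simp only [bilin_comm Q _ z, bilin_add_right]

theorem bilin_smul_left (Q : quadForms d) (x y : Fin d → ℝ) (a : ℝ) :
    bilin Q (a • x) y = a * bilin Q x y := by
  simp only [bilin_comm Q _ y, bilin_smul_right]

theorem value_add (Q : quadForms d) (x y : Fin d → ℝ) :
    value Q (x + y) = value Q x + 2 * bilin Q x y + value Q y := by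
  simp only [← bilin_self, bilin_add_left, bilin_add_right, bilin_comm Q y x]
  ring

theorem value_smul (Q : quadForms d) (a : ℝ) (x : Fin d → ℝ) :
    value Q (a • x) = a ^ 2 * value Q x := by
  simp only [← bilin_self, bilin_smul_left, bilin_smul_right]
  ring

theorem value_neg (Q : quadForms d) (x : Fin d → ℝ) : value Q (-x) = value Q x := by
  rw [← neg_one_smul ℝ x, value_smul]
  norm_num

theorem value_sub (Q : quadForms d) (x y : Fin d → ℝ) :
    value Q (x - y) = value Q x - 2 * bilin Q x y + value Q y := by
  rw [sub_eq_add_neg, value_add, value_neg, ← neg_one_smul ℝ y, bilin_smul_right]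
  ring

theorem value_sub_comm (Q : quadForms d) (x y : Fin d → ℝ) :
    value Q (x - y) = value Q (y - x) := by
  rw [← value_neg, neg_sub]

theorem value_eq_sum (Q : quadForms d) (x : Fin d → ℝ) :
    value Q x = ∑ i, ∑ j, x i * ((Q : Matrix (Fin d) (Fin d) ℝ) i j * x j) := by
  simp only [value, dotProduct, Matrix.mulVec, Finset.mul_sum]

/-- Steiner's identity for weighted points. -/
theorem sum_mul_value_sub (Q : quadForms d) {ι : Type*} (s : Finset ι) {β : ι → ℝ}
    {v : ι → Fin d → ℝ} {x : Fin d → ℝ} (h1 : ∑ j ∈ s, β j = 1) (hx : ∑ j ∈ s, β j • v j = x)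
    (c : Fin d → ℝ) :
    ∑ j ∈ s, β j * value Q (v j - c) = value Q (x - c) + ∑ j ∈ s, β j * value Q (v j - x) := by
  have key : ∀ c : Fin d → ℝ, ∑ j ∈ s, β j * value Q (v j - c) =
      ∑ j ∈ s, β j * value Q (v j) - 2 * bilin Q c x + value Q c := by
    intro c
    rw [← hx, bilin_sum_right, Finset.mul_sum, ← Finset.sum_sub_distrib,
      ← one_mul (value Q c), ← h1, Finset.sum_mul, ← Finset.sum_add_distrib]
    refine Finset.sum_congr rfl fun j _ => ?_
    rw [value_sub, bilin_comm Q _ c]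
    ring
  rw [key c, key x, value_sub, bilin_self, bilin_comm Q c x]
  ring

theorem value_pos {Q : quadForms d} (hQ : Q ∈ pqf d) {x : Fin d → ℝ} (hx : x ≠ 0) :
    0 < value Q x := by
  have h := Matrix.PosDef.dotProduct_mulVec_pos (show Matrix.PosDef _ from hQ) hx
  simpa [value] using h

theorem mem_pqf_iff {Q : quadForms d} : Q ∈ pqf d ↔ ∀ x : Fin d → ℝ, x ≠ 0 → 0 < value Q x := by
  refine ⟨fun hQ x hx => value_pos hQ hx, fun h => ?_⟩
  refine Matrix.posDef_iff_dotProduct_mulVec.2 ⟨?_, fun x hx => ?_⟩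
  · have hQ : (Q : Matrix (Fin d) (Fin d) ℝ).transpose = Q := Q.2
    rwa [Matrix.IsHermitian, Matrix.conjTranspose_eq_transpose_of_trivial]
  · simpa [value] using h x hx

theorem value_zero (Q : quadForms d) : value Q 0 = 0 := by simp [value]

theorem value_nonneg {Q : quadForms d} (hQ : Q ∈ pqf d) (x : Fin d → ℝ) : 0 ≤ value Q x := by
  by_cases hx : x = 0
  · rw [hx, value_zero]
  · exact (value_pos hQ hx).le

theorem continuous_value : Continuous fun p : quadForms d × (Fin d → ℝ) => value p.1 p.2 := by
  simp only [value_eq_sum]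
  refine continuous_finsetSum _ fun i _ => continuous_finsetSum _ fun j _ => ?_
  have h : Continuous fun p : quadForms d × (Fin d → ℝ) =>
      (p.1 : Matrix (Fin d) (Fin d) ℝ) i j :=
    (continuous_subtype_val.comp continuous_fst).matrix_elem i j
  exact ((continuous_apply i).comp continuous_snd).mul
    (h.mul ((continuous_apply j).comp continuous_snd))

theorem continuous_value_left (x : Fin d → ℝ) : Continuous fun Q : quadForms d => value Q x :=
  continuous_value.comp (by fun_prop : Continuous fun Q : quadForms d => (Q, x))

theorem continuous_value_right (Q : quadForms d) : Continuous (value Q) :=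
  continuous_value.comp (by fun_prop : Continuous fun x : Fin d → ℝ => (Q, x))

/-- Compactness of the unit sphere and homogeneity of degree 2. -/
theorem exists_pos_mul_norm_sq_le {Q : quadForms d} (hQ : Q ∈ pqf d) :
    ∃ m : ℝ, 0 < m ∧ ∀ x, m * ‖x‖ ^ 2 ≤ value Q x := by
  obtain ⟨m, hm, h⟩ : ∃ m : ℝ, 0 < m ∧ ∀ x ∈ Metric.sphere (0 : Fin d → ℝ) 1, m ≤ value Q x := by
    rcases (Metric.sphere (0 : Fin d → ℝ) 1).eq_empty_or_nonempty with he | hne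
    -- The sphere is empty when `d = 0`.
    · exact ⟨1, one_pos, by simp [he]⟩
    · obtain ⟨x, hx, hmin⟩ := (isCompact_sphere (0 : Fin d → ℝ) 1).exists_isMinOn hne
        (continuous_value_right Q).continuousOn
      refine ⟨value Q x, value_pos hQ ?_, fun y hy => hmin hy⟩
      rintro rfl
      simp at hx
  refine ⟨m, hm, fun x => ?_⟩
  by_cases hx : x = 0
  · simp [hx, value_zero]
  · have hn : ‖x‖ ≠ 0 := norm_ne_zero_iff.2 hx
    have h2 := h (‖x‖⁻¹ • x) (by simp [norm_smul, hn])
    rw [value_smul] at h2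
    have h3 : value Q x = ‖x‖ ^ 2 * (‖x‖⁻¹ ^ 2 * value Q x) := by field_simp
    rw [h3, mul_comm]
    exact mul_le_mul_of_nonneg_left h2 (by positivity)

/-- Positivity on the compact unit sphere persists under small perturbations of `Q`. -/
theorem isOpen_pqf : IsOpen (pqf d) := by
  rw [isOpen_iff_mem_nhds]
  intro Q hQ
  have h : ∀ᶠ Q' in 𝓝 Q, ∀ x ∈ Metric.sphere (0 : Fin d → ℝ) 1, 0 < value Q' x := by
    refine (isCompact_sphere _ _).eventually_forall_of_forall_eventually fun x hx => ?_
    refine continuous_value.continuousAt.eventually (lt_mem_nhds (value_pos hQ ?_))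
    rintro rfl
    simp at hx
  filter_upwards [h] with Q' hQ'
  refine mem_pqf_iff.2 fun x hx => ?_
  have hn : ‖x‖ ≠ 0 := norm_ne_zero_iff.2 hx
  have h2 := hQ' (‖x‖⁻¹ • x) (by simp [norm_smul, hn])
  rw [value_smul] at h2
  exact (mul_pos_iff_of_pos_left (by positivity)).1 h2

theorem toReal_add (m n : Fin d → ℤ) : toReal (m + n) = toReal m + toReal n := by
  ext i; simp [toReal]

theorem toReal_sub (m n : Fin d → ℤ) : toReal (m - n) = toReal m - toReal n := by
  ext i; simp [toReal]

theorem toReal_sum_smul {ι : Type*} (s : Finset ι) (a : ι → ℤ) (v : ι → Fin d → ℤ) :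
    toReal (∑ i ∈ s, a i • v i) = ∑ i ∈ s, (a i : ℝ) • toReal (v i) := by
  ext l; simp [toReal]

theorem tendsto_toReal_cofinite : Tendsto (toReal (d := d)) cofinite (cocompact (Fin d → ℝ)) := by
  have := Tendsto.pi_map_coprodᵢ (ι := Fin d) (fun _ => Int.tendsto_coe_cofinite)
  rwa [coprodᵢ_cofinite, coprodᵢ_cocompact] at this

/-- Source of both the finiteness of lattice points in an ellipsoid and the existence of a cell of
minimal power. -/
theorem tendsto_value_sub_cofinite {Q : quadForms d} (hQ : Q ∈ pqf d) (c : Fin d → ℝ) :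
    Tendsto (fun n : Fin d → ℤ => value Q (toReal n - c)) cofinite atTop := by
  obtain ⟨m, hm, h⟩ := exists_pos_mul_norm_sq_le hQ
  refine tendsto_atTop_mono (fun n => h _) ?_
  refine Tendsto.const_mul_atTop hm ((tendsto_pow_atTop two_ne_zero).comp ?_)
  refine tendsto_atTop_mono (fun n => norm_sub_norm_le (toReal n) c) ?_
  exact tendsto_atTop_add_const_right _ _
    (tendsto_norm_cocompact_atTop.comp tendsto_toReal_cofinite)

end Value

/-! ### Unimodular lattice simplices -/

section Simplex

variable {d : ℕ}

/-- The vertices of `L` generate `ℤ^d` as an affine lattice. -/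
def IsUnimodular (L : Fin (d + 1) → Fin d → ℤ) : Prop :=
  ∀ n : Fin d → ℤ, ∃ α : Fin (d + 1) → ℤ, ∑ j, α j = 1 ∧ ∑ j, α j • L j = n

/-- `β` are barycentric coordinates of `x` with respect to the vertices of `L`. -/
def IsBary (L : Fin (d + 1) → Fin d → ℤ) (x : Fin d → ℝ) (β : Fin (d + 1) → ℝ) : Prop :=
  ∑ j, β j = 1 ∧ ∑ j, β j • toReal (L j) = x

/-- The linear map sending coefficients to their sum and to the combination of the vertices. -/
def combination (L : Fin (d + 1) → Fin d → ℤ) :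
    (Fin (d + 1) → ℝ) →ₗ[ℝ] ℝ × (Fin d → ℝ) where
  toFun β := (∑ j, β j, ∑ j, β j • toReal (L j))
  map_add' β γ := by simp [Finset.sum_add_distrib, add_smul]
  map_smul' a β := by simp [Finset.mul_sum, Finset.smul_sum, smul_smul]

theorem combination_apply (L : Fin (d + 1) → Fin d → ℤ) (β : Fin (d + 1) → ℝ) :
    combination L β = (∑ j, β j, ∑ j, β j • toReal (L j)) := rfl

theorem isBary_iff {L : Fin (d + 1) → Fin d → ℤ} {x : Fin d → ℝ} {β : Fin (d + 1) → ℝ} :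
    IsBary L x β ↔ combination L β = (1, x) := by
  rw [combination_apply, Prod.mk.injEq, IsBary]

theorem IsUnimodular.exists_isBary {L : Fin (d + 1) → Fin d → ℤ} (hL : IsUnimodular L)
    (n : Fin d → ℤ) : ∃ α : Fin (d + 1) → ℤ, IsBary L (toReal n) fun j => (α j : ℝ) := by
  obtain ⟨α, h1, h2⟩ := hL n
  refine ⟨α, by beta_reduce; exact_mod_cast h1, ?_⟩
  rw [← h2, toReal_sum_smul]

theorem IsUnimodular.combination_surjective {L : Fin (d + 1) → Fin d → ℤ}
    (hL : IsUnimodular L) : Function.Surjective (combination L) := by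
  choose α hα using hL.exists_isBary
  rintro ⟨a, x⟩
  have h : ∀ n, combination L (fun j => (α n j : ℝ)) = (1, toReal n) := fun n =>
    isBary_iff.1 (hα n)
  have h0 : toReal (0 : Fin d → ℤ) = 0 := by ext; simp [toReal]
  -- The coefficients for the origin have sum 1; differences of coefficients for `e_i` and the
  -- origin have sum 0 and represent `e_i`.
  refine ⟨a • (fun j => (α 0 j : ℝ)) +
    ∑ i, x i • ((fun j => (α (Pi.single i 1) j : ℝ)) - fun j => (α 0 j : ℝ)), ?_⟩
  simp only [map_add, map_smul, map_sum, map_sub, h, h0]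
  ext l
  · simp [Prod.fst_sum]
  · simp [Prod.snd_sum, Finset.sum_apply, toReal, Pi.single_apply]

theorem IsUnimodular.combination_bijective {L : Fin (d + 1) → Fin d → ℤ}
    (hL : IsUnimodular L) : Function.Bijective (combination L) := by
  refine ⟨?_, hL.combination_surjective⟩
  rw [LinearMap.injective_iff_surjective_of_finrank_eq_finrank]
  · exact hL.combination_surjective
  · simp [add_comm]

/-- The barycentric coordinates with respect to a unimodular simplex. -/
noncomputable def bary (L : Fin (d + 1) → Fin d → ℤ) (x : Fin d → ℝ) : Fin (d + 1) → ℝ :=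
  Classical.epsilon (IsBary L x)

theorem IsUnimodular.isBary {L : Fin (d + 1) → Fin d → ℤ} (hL : IsUnimodular L)
    (x : Fin d → ℝ) : IsBary L x (bary L x) := by
  obtain ⟨β, hβ⟩ := hL.combination_surjective (1, x)
  exact Classical.epsilon_spec (p := IsBary L x) ⟨β, isBary_iff.2 hβ⟩

theorem IsUnimodular.bary_eq {L : Fin (d + 1) → Fin d → ℤ} (hL : IsUnimodular L)
    {x : Fin d → ℝ} {β : Fin (d + 1) → ℝ} (h : IsBary L x β) : bary L x = β :=
  hL.combination_bijective.1 ((isBary_iff.1 (hL.isBary x)).trans (isBary_iff.1 h).symm)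

theorem IsUnimodular.bary_vertex {L : Fin (d + 1) → Fin d → ℤ} (hL : IsUnimodular L)
    (j : Fin (d + 1)) : bary L (toReal (L j)) = Pi.single j 1 :=
  hL.bary_eq ⟨by simp, by simp [Pi.single_apply, ite_smul]⟩

/-- Barycentric coordinates are affine. -/
theorem IsUnimodular.bary_combination {L L' : Fin (d + 1) → Fin d → ℤ} (hL : IsUnimodular L)
    {x : Fin d → ℝ} {β : Fin (d + 1) → ℝ} (h : IsBary L' x β) :
    bary L x = ∑ j, β j • bary L (toReal (L' j)) := by
  refine hL.bary_eq (isBary_iff.2 ?_)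
  simp only [map_sum, map_smul, isBary_iff.1 (hL.isBary _)]
  ext l
  · simp [Prod.fst_sum, h.1]
  · simp [Prod.snd_sum, ← h.2]

theorem IsBary.translate {L : Fin (d + 1) → Fin d → ℤ} {x : Fin d → ℝ} {β : Fin (d + 1) → ℝ}
    (h : IsBary L x β) (t : Fin d → ℤ) : IsBary (fun j => L j + t) (x + toReal t) β := by
  refine ⟨h.1, ?_⟩
  simp only [toReal_add, smul_add, Finset.sum_add_distrib, ← Finset.sum_smul, h.1, h.2, one_smul]

theorem IsUnimodular.translate {L : Fin (d + 1) → Fin d → ℤ} (hL : IsUnimodular L)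
    (t : Fin d → ℤ) : IsUnimodular fun j => L j + t := by
  intro n
  obtain ⟨α, h1, h2⟩ := hL (n - t)
  refine ⟨α, h1, ?_⟩
  simp only [smul_add, Finset.sum_add_distrib, h2, ← Finset.sum_smul, h1, one_smul,
    sub_add_cancel]

theorem IsUnimodular.bary_translate {L : Fin (d + 1) → Fin d → ℤ} (hL : IsUnimodular L)
    (t : Fin d → ℤ) (x : Fin d → ℝ) :
    bary (fun j => L j + t) (x + toReal t) = bary L x :=
  (hL.translate t).bary_eq ((hL.isBary x).translate t)

/-- A lattice point with nonnegative barycentric coordinates is a vertex. -/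
theorem IsUnimodular.exists_eq_of_bary_nonneg {L : Fin (d + 1) → Fin d → ℤ}
    (hL : IsUnimodular L) {n : Fin d → ℤ} (h : ∀ j, 0 ≤ bary L (toReal n) j) :
    ∃ j, L j = n := by
  obtain ⟨α, h1, h2⟩ := hL n
  -- Unimodularity makes the coordinates of a lattice point integers; nonnegative integers with sum
  -- 1 are a single 1 and zeros.
  have hb : bary L (toReal n) = fun j => (α j : ℝ) := by
    refine hL.bary_eq ⟨by beta_reduce; exact_mod_cast h1, ?_⟩
    rw [← h2, toReal_sum_smul]
  have hα : ∀ j, 0 ≤ α j := fun j => by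
    have := h j
    simp only [hb] at this
    exact_mod_cast this
  obtain ⟨j, hj⟩ : ∃ j, 0 < α j := by
    by_contra! hcon
    have : ∑ j, α j ≤ 0 := Finset.sum_nonpos fun j _ => hcon j
    omega
  have h3 : α j + ∑ i ∈ Finset.univ.erase j, α i = 1 := by
    rw [Finset.add_sum_erase _ _ (Finset.mem_univ j), h1]
  have h4 : 0 ≤ ∑ i ∈ Finset.univ.erase j, α i := Finset.sum_nonneg fun i _ => hα i
  have h5 : ∀ i ∈ Finset.univ.erase j, α i = 0 :=
    (Finset.sum_eq_zero_iff_of_nonneg fun i _ => hα i).1 (by omega)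
  refine ⟨j, ?_⟩
  rw [← h2, Finset.sum_eq_single j]
  · rw [show α j = 1 by omega, one_smul]
  · intro i _ hij
    rw [h5 i (Finset.mem_erase.2 ⟨hij, Finset.mem_univ i⟩), zero_smul]
  · simp

/-- The power of `x` with respect to the circumsphere of `L`: the value of `Q` minus its affine
interpolation at the vertices. -/
noncomputable def power (Q : quadForms d) (L : Fin (d + 1) → Fin d → ℤ) (x : Fin d → ℝ) : ℝ :=
  value Q x - ∑ j, bary L x j * value Q (toReal (L j))

theorem continuous_power_left (L : Fin (d + 1) → Fin d → ℤ) (x : Fin d → ℝ) :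
    Continuous fun Q : quadForms d => power Q L x :=
  (continuous_value_left x).sub
    (continuous_finsetSum _ fun _ _ => continuous_const.mul (continuous_value_left _))

/-- Steiner's identity with the origin as centre. This links the power to weighted moments, which
are linear in `Q` and computable from integer tables. -/
theorem IsUnimodular.power_eq {L : Fin (d + 1) → Fin d → ℤ} (hL : IsUnimodular L)
    (Q : quadForms d) {x : Fin d → ℝ} {β : Fin (d + 1) → ℝ} (h : IsBary L x β) :
    power Q L x = -∑ j, β j * value Q (toReal (L j) - x) := by
  have := sum_mul_value_sub Q Finset.univ h.1 h.2 0
  simp only [sub_zero] at this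
  rw [power, hL.bary_eq h, this]
  ring

theorem IsUnimodular.power_vertex {L : Fin (d + 1) → Fin d → ℤ} (hL : IsUnimodular L)
    (Q : quadForms d) (j : Fin (d + 1)) : power Q L (toReal (L j)) = 0 := by
  simp [power, hL.bary_vertex, Pi.single_apply]

theorem IsUnimodular.power_translate {L : Fin (d + 1) → Fin d → ℤ} (hL : IsUnimodular L)
    (Q : quadForms d) (t : Fin d → ℤ) (x : Fin d → ℝ) :
    power Q (fun j => L j + t) (x + toReal t) = power Q L x := by
  rw [hL.power_eq Q (hL.isBary x), (hL.translate t).power_eq Q ((hL.isBary x).translate t)]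
  simp only [toReal_add, add_sub_add_right_eq_sub]

/-- Both power functions have quadratic part `Q`, so their difference is affine and determined by
its values at the vertices of `L`, where `power Q L` vanishes. -/
theorem IsUnimodular.power_eq_add {L L' : Fin (d + 1) → Fin d → ℤ} (hL : IsUnimodular L)
    (hL' : IsUnimodular L') (Q : quadForms d) (x : Fin d → ℝ) :
    power Q L' x = power Q L x + ∑ j, bary L x j * power Q L' (toReal (L j)) := by
  have h := hL'.bary_combination (hL.isBary x)
  have h2 : ∑ j, bary L x j * ∑ i, bary L' (toReal (L j)) i * value Q (toReal (L' i)) =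
      ∑ i, bary L' x i * value Q (toReal (L' i)) := by
    simp only [h, Finset.sum_apply, Pi.smul_apply, smul_eq_mul, Finset.mul_sum, Finset.sum_mul,
      mul_assoc]
    exact Finset.sum_comm
  simp only [power, mul_sub, Finset.sum_sub_distrib, h2]
  ring

/-- Interpolation of prescribed values at the vertices by power functions. -/
theorem IsUnimodular.exists_sphere {L : Fin (d + 1) → Fin d → ℤ} (hL : IsUnimodular L)
    {Q : quadForms d} (hQ : Q ∈ pqf d) (g : Fin (d + 1) → ℝ) :
    ∃ (c : Fin d → ℝ) (R : ℝ), ∀ j, value Q (toReal (L j) - c) = R + g j := by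
  let Φ : ℝ × (Fin d → ℝ) →ₗ[ℝ] (Fin (d + 1) → ℝ) :=
    { toFun := fun p j => p.1 + 2 * bilin Q p.2 (toReal (L j))
      map_add' := fun p p' => by
        ext j; simp only [Prod.fst_add, Prod.snd_add, bilin_add_left, Pi.add_apply]; ring
      map_smul' := fun a p => by
        ext j
        simp only [Prod.smul_fst, Prod.smul_snd, bilin_smul_left, Pi.smul_apply, smul_eq_mul,
          RingHom.id_apply]
        ring }
  -- An affine function vanishing at all vertices vanishes identically; evaluating at 0 and at `c`
  -- kills `b` and, by definiteness, `c`.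
  have hinj : Function.Injective Φ := by
    rw [← LinearMap.ker_eq_bot, LinearMap.ker_eq_bot']
    rintro ⟨b, c⟩ h
    have h1 : ∀ j, b + 2 * bilin Q c (toReal (L j)) = 0 := fun j => congrFun h j
    have h2 : ∀ x, b + 2 * bilin Q c x = 0 := by
      intro x
      have hx := hL.isBary x
      have h3 : ∑ j, bary L x j * (b + 2 * bilin Q c (toReal (L j))) = b + 2 * bilin Q c x := by
        conv_rhs => rw [← hx.2, bilin_sum_right, Finset.mul_sum, ← one_mul b, ← hx.1,
          Finset.sum_mul, ← Finset.sum_add_distrib]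
        exact Finset.sum_congr rfl fun j _ => by ring
      rw [← h3]
      exact Finset.sum_eq_zero fun j _ => by rw [h1, mul_zero]
    have hb : b = 0 := by simpa [bilin] using h2 0
    have hc : c = 0 := by
      by_contra hc
      have := value_pos hQ hc
      have h3 := h2 c
      rw [bilin_self] at h3
      linarith
    rw [hb, hc]; rfl
  have hsurj : Function.Surjective Φ := by
    rwa [← LinearMap.injective_iff_surjective_of_finrank_eq_finrank]
    simp [add_comm]
  obtain ⟨⟨b, c⟩, h⟩ := hsurj fun j => value Q (toReal (L j)) - g j
  refine ⟨c, b + value Q c, fun j => ?_⟩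
  have hj : b + 2 * bilin Q c (toReal (L j)) = value Q (toReal (L j)) - g j := congrFun h j
  rw [value_sub, bilin_comm Q _ c]
  linarith

theorem IsUnimodular.power_eq_value_sub {L : Fin (d + 1) → Fin d → ℤ} (hL : IsUnimodular L)
    {Q : quadForms d} {c : Fin d → ℝ} {R : ℝ}
    (h : ∀ j, value Q (toReal (L j) - c) = R) (x : Fin d → ℝ) :
    power Q L x = value Q (x - c) - R := by
  have hx := hL.isBary x
  have := sum_mul_value_sub Q Finset.univ hx.1 hx.2 c
  simp only [h, ← Finset.sum_mul, hx.1, one_mul] at this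
  rw [hL.power_eq Q hx]
  linarith

theorem IsUnimodular.exists_circumsphere {L : Fin (d + 1) → Fin d → ℤ} (hL : IsUnimodular L)
    {Q : quadForms d} (hQ : Q ∈ pqf d) :
    ∃ (c : Fin d → ℝ) (R : ℝ), ∀ x, power Q L x = value Q (x - c) - R := by
  obtain ⟨c, R, h⟩ := hL.exists_sphere hQ 0
  exact ⟨c, R, hL.power_eq_value_sub fun j => by simpa using h j⟩

end Simplex

/-! ### Periodic families of simplices closed under passing to neighbours -/

/-- A finite family of unimodular simplices together with, for each facet, a lattice point on the
other side of the facet such that the simplex it spans with the facet is a lattice translate of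
a member of the family. -/
structure PeriodicTriangulation (d : ℕ) (ι : Type*) where
  simplex : ι → Fin (d + 1) → Fin d → ℤ
  unimodular : ∀ k, IsUnimodular (simplex k)
  apex : ι → Fin (d + 1) → Fin d → ℤ
  apex_neg : ∀ k i, bary (simplex k) (toReal (apex k i)) i < 0
  neighbor : ι → Fin (d + 1) → ι
  shift : ι → Fin (d + 1) → Fin d → ℤ
  facet_mem : ∀ k i j, j ≠ i →
    ∃ m, simplex (neighbor k i) m + shift k i = simplex k j
  apex_mem : ∀ k i, ∃ m, simplex (neighbor k i) m + shift k i = apex k i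

namespace PeriodicTriangulation

variable {d : ℕ} {ι : Type*} (T : PeriodicTriangulation d ι)

/-- The translates of the simplices of the family. -/
def cell (k : ι) (t : Fin d → ℤ) : Fin (d + 1) → Fin d → ℤ := fun j => T.simplex k j + t

theorem unimodular_cell (k : ι) (t : Fin d → ℤ) : IsUnimodular (T.cell k t) :=
  (T.unimodular k).translate t

/-- Each apex lies outside the circumsphere of the simplex on the other side. -/
def IsRegular (Q : quadForms d) : Prop :=
  ∀ k i, 0 < power Q (T.simplex k) (toReal (T.apex k i))

theorem power_cell (Q : quadForms d) (k : ι) (t : Fin d → ℤ) (x : Fin d → ℝ) :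
    power Q (T.cell k t) x = power Q (T.simplex k) (x - toReal t) := by
  rw [← (T.unimodular k).power_translate Q t, sub_add_cancel]
  rfl

theorem bary_cell (k : ι) (t : Fin d → ℤ) (x : Fin d → ℝ) :
    bary (T.cell k t) x = bary (T.simplex k) (x - toReal t) := by
  rw [← (T.unimodular k).bary_translate t, sub_add_cancel]
  rfl

/-- Finitely many strict inequalities, each continuous in `Q`. -/
theorem eventually_isRegular [Finite ι] {Q : quadForms d} (h : T.IsRegular Q) :
    ∀ᶠ Q' in 𝓝 Q, T.IsRegular Q' := by
  refine eventually_all.2 fun k => eventually_all.2 fun i => ?_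
  exact (continuous_power_left _ _).continuousAt.eventually (lt_mem_nhds (h k i))

/-- A cell whose power at `x` is minimal contains `x`. -/
theorem bary_nonneg_of_forall_power_le {Q : quadForms d} (hreg : T.IsRegular Q) {k : ι}
    {t : Fin d → ℤ} {x : Fin d → ℝ}
    (hmin : ∀ k' t', power Q (T.cell k t) x ≤ power Q (T.cell k' t') x) (i : Fin (d + 1)) :
    0 ≤ bary (T.cell k t) x i := by
  by_contra! hneg
  rw [bary_cell] at hneg
  set z := x - toReal t
  set L := T.simplex k
  set L' := T.cell (T.neighbor k i) (T.shift k i) with hL'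
  have hu : IsUnimodular L := T.unimodular k
  have hu' : IsUnimodular L' := T.unimodular_cell _ _
  have hvert : ∀ n, (∃ m, L' m = n) → power Q L' (toReal n) = 0 := by
    rintro n ⟨m, rfl⟩
    exact hu'.power_vertex Q m
  -- The cells share all vertices but `L i`, so their powers differ by a multiple of the barycentric
  -- coordinate vanishing on the common facet.
  have key : ∀ y, power Q L' y = power Q L y + bary L y i * power Q L' (toReal (L i)) := by
    intro y
    rw [hu.power_eq_add hu' Q y, Finset.sum_eq_single i]
    · intro j _ hj
      rw [hvert _ (T.facet_mem k i j hj), mul_zero]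
    · simp
  -- At the apex the left side is 0, the power for `L` is positive and the coordinate is negative;
  -- this fixes the sign of the multiple.
  have h1 := key (toReal (T.apex k i))
  rw [hvert _ (T.apex_mem k i)] at h1
  have h2 := hreg k i
  have h3 := T.apex_neg k i
  have h4 : 0 < power Q L' (toReal (L i)) := by
    by_contra! hcon
    have := mul_nonneg_of_nonpos_of_nonpos h3.le hcon
    linarith
  have h5 : power Q L' z < power Q L z := by
    rw [key z]
    have := mul_neg_of_neg_of_pos hneg h4
    linarith
  have h6 := hmin (T.neighbor k i) (T.shift k i + t)
  rw [T.power_cell, T.power_cell, toReal_add, add_comm (toReal _), ← sub_sub] at h6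
  rw [hL', T.power_cell] at h5
  exact absurd h6 (not_le.2 h5)

/-- For a fixed class the power at `x` tends to infinity over the translates, so it has a minimum;
there are finitely many classes. -/
theorem exists_forall_power_le [Finite ι] [Nonempty ι] {Q : quadForms d} (hQ : Q ∈ pqf d)
    (x : Fin d → ℝ) :
    ∃ k t, ∀ k' t', power Q (T.cell k t) x ≤ power Q (T.cell k' t') x := by
  have h : ∀ k, ∃ t, ∀ t', power Q (T.cell k t) x ≤ power Q (T.cell k t') x := by
    intro k
    obtain ⟨c, R, hc⟩ := (T.unimodular k).exists_circumsphere hQ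
    refine Filter.Tendsto.exists_forall_le (f := fun t => power Q (T.cell k t) x) ?_
    simp only [T.power_cell, hc]
    refine tendsto_atTop_add_const_right _ _ ?_
    refine (tendsto_value_sub_cofinite hQ (x - c)).congr fun n => ?_
    rw [value_sub_comm]
    congr 1
    abel
  choose t ht using h
  obtain ⟨k, hk⟩ := Finite.exists_min fun k => power Q (T.cell k (t k)) x
  exact ⟨k, t k, fun k' t' => (hk k').trans (ht k' t')⟩

theorem exists_bary_nonneg [Finite ι] [Nonempty ι] {Q : quadForms d} (hQ : Q ∈ pqf d)
    (hreg : T.IsRegular Q) (x : Fin d → ℝ) : ∃ k t, ∀ i, 0 ≤ bary (T.cell k t) x i := by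
  obtain ⟨k, t, h⟩ := T.exists_forall_power_le hQ x
  exact ⟨k, t, T.bary_nonneg_of_forall_power_le hreg h⟩

/-- The circumspheres of the cells are empty. -/
theorem power_nonneg [Finite ι] [Nonempty ι] {Q : quadForms d} (hQ : Q ∈ pqf d)
    (hreg : T.IsRegular Q) (k : ι) (t n : Fin d → ℤ) : 0 ≤ power Q (T.cell k t) (toReal n) := by
  -- The minimal cell at a lattice point contains it, hence has it as a vertex, and the minimal
  -- power is 0.
  obtain ⟨k', t', h⟩ := T.exists_forall_power_le hQ (toReal n)
  obtain ⟨j, rfl⟩ := (T.unimodular_cell k' t').exists_eq_of_bary_nonneg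
    (T.bary_nonneg_of_forall_power_le hreg h)
  have := h k t
  rwa [(T.unimodular_cell k' t').power_vertex] at this

/-- By `power_nonneg` the value 0 is minimal among all cells, so the cell contains the lattice
point. -/
theorem exists_eq_of_power_eq_zero [Finite ι] [Nonempty ι] {Q : quadForms d} (hQ : Q ∈ pqf d)
    (hreg : T.IsRegular Q) {k : ι} {t n : Fin d → ℤ}
    (h0 : power Q (T.cell k t) (toReal n) = 0) : ∃ j, T.cell k t j = n := by
  refine (T.unimodular_cell k t).exists_eq_of_bary_nonneg
    (T.bary_nonneg_of_forall_power_le hreg fun k' t' => ?_)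
  rw [h0]
  exact T.power_nonneg hQ hreg k' t' n

theorem isDelonePolytope_face [Finite ι] [Nonempty ι] {Q : quadForms d} (hQ : Q ∈ pqf d)
    (hreg : T.IsRegular Q) (k : ι) (t : Fin d → ℤ) {J : Finset (Fin (d + 1))}
    (hJ : J.Nonempty) :
    IsDelonePolytope Q (convexHull ℝ (toReal '' (T.cell k t '' (J : Set (Fin (d + 1)))))) := by
  classical
  set L := T.cell k t
  have hL : IsUnimodular L := T.unimodular_cell k t
  obtain ⟨c₀, R₀, h₀⟩ := hL.exists_circumsphere hQ
  -- A sphere through the vertices in `J` with the other vertices strictly outside. Moving the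
  -- circumsphere slightly towards it cuts out exactly the face `J`.
  obtain ⟨c₁, R₁, h₁⟩ := hL.exists_sphere hQ fun j => if j ∈ J then 0 else 1
  have hfin : {n : Fin d → ℤ | value Q (toReal n - c₁) ≤ R₁}.Finite := by
    have := (tendsto_value_sub_cofinite hQ c₁).eventually (eventually_gt_atTop R₁)
    rw [eventually_cofinite] at this
    simpa using this
  -- Only the finitely many lattice points inside or on the second sphere restrict `ε`.
  have hev : ∀ᶠ ε in 𝓝[>] (0 : ℝ), ∀ n ∈ {n : Fin d → ℤ | value Q (toReal n - c₁) ≤ R₁},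
      0 < power Q L (toReal n) →
      0 < (1 - ε) * power Q L (toReal n) + ε * (value Q (toReal n - c₁) - R₁) := by
    refine (eventually_all_finite hfin).2 fun n _ => ?_
    by_cases hn : 0 < power Q L (toReal n)
    · have hcont : Continuous fun ε : ℝ =>
          (1 - ε) * power Q L (toReal n) + ε * (value Q (toReal n - c₁) - R₁) := by fun_prop
      have := (hcont.tendsto 0).eventually (lt_mem_nhds (a := 0) (by simpa using hn))
      filter_upwards [this.filter_mono nhdsWithin_le_nhds] with ε hε _ using hε
    · simp [hn]
  obtain ⟨ε, hε, hε0, hε1⟩ := (hev.and (Ioo_mem_nhdsGT (zero_lt_one (α := ℝ)))).exists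
  set c := (1 - ε) • c₀ + ε • c₁ with hc
  -- Sphere functions have the same quadratic part, so a combination with weights `1 - ε` and `ε` is
  -- again one, centred at the combined centre.
  obtain ⟨R, hR⟩ : ∃ R, ∀ x, value Q (x - c) - R =
      (1 - ε) * power Q L x + ε * (value Q (x - c₁) - R₁) := by
    refine ⟨value Q c - (1 - ε) * (value Q c₀ - R₀) - ε * (value Q c₁ - R₁), fun x => ?_⟩
    rw [h₀, value_sub, value_sub, value_sub, hc, bilin_add_right, bilin_smul_right,
      bilin_smul_right]
    ring
  have hmem : ∀ j ∈ J, value Q (toReal (L j) - c) = R := by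
    intro j hj
    have := hR (toReal (L j))
    rw [hL.power_vertex, h₁, if_pos hj] at this
    linarith
  obtain ⟨j₀, hj₀⟩ := hJ
  have hRpos : 0 ≤ R := by rw [← hmem j₀ hj₀]; exact value_nonneg hQ _
  refine ⟨J.image L, ⟨L j₀, Finset.mem_image_of_mem L hj₀⟩, by rw [Finset.coe_image], c, √R,
    ?_, ?_⟩
  · intro v hv
    obtain ⟨j, hj, rfl⟩ := Finset.mem_image.1 hv
    rw [Real.sq_sqrt hRpos, hmem j hj]
  · intro v hv
    rw [Real.sq_sqrt hRpos]
    have hpos : 0 < (1 - ε) * power Q L (toReal v) + ε * (value Q (toReal v - c₁) - R₁) := by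
      by_cases hvert : ∃ j, L j = v
      · obtain ⟨j, rfl⟩ := hvert
        have hj : j ∉ J := fun hj => hv (Finset.mem_image_of_mem L hj)
        rw [hL.power_vertex, h₁, if_neg hj]
        linarith
      · have hp : 0 < power Q L (toReal v) :=
          lt_of_le_of_ne (T.power_nonneg hQ hreg k t v)
            fun h => hvert (T.exists_eq_of_power_eq_zero hQ hreg h.symm)
        by_cases hle : value Q (toReal v - c₁) ≤ R₁
        · exact hε v hle hp
        · have h2 : 0 < value Q (toReal v - c₁) - R₁ := by linarith
          have h3 : 0 < 1 - ε := by linarith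
          positivity
    have := hR (toReal v)
    linarith

theorem exists_face_of_isDelonePolytope [Finite ι] [Nonempty ι] {Q : quadForms d}
    (hQ : Q ∈ pqf d) (hreg : T.IsRegular Q) {D : Set (Fin d → ℝ)} (hD : IsDelonePolytope Q D) :
    ∃ k t, ∃ J : Finset (Fin (d + 1)), J.Nonempty ∧
      D = convexHull ℝ (toReal '' (T.cell k t '' (J : Set (Fin (d + 1))))) := by
  classical
  obtain ⟨V, hV, rfl, c, r, hin, hout⟩ := hD
  have hcard : (0 : ℝ) < V.card := by exact_mod_cast hV.card_pos
  -- The centroid of `V` lies in some cell `L`; the aim is that all points of `V` lie on the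
  -- circumsphere of `L`.
  set x : Fin d → ℝ := ∑ v ∈ V, (V.card : ℝ)⁻¹ • toReal v with hx
  have hw : ∑ _v ∈ V, (V.card : ℝ)⁻¹ = 1 := by
    rw [Finset.sum_const, nsmul_eq_mul, mul_inv_cancel₀ hcard.ne']
  obtain ⟨k, t, hb⟩ := T.exists_bary_nonneg hQ hreg x
  set L := T.cell k t
  have hL : IsUnimodular L := T.unimodular_cell k t
  obtain ⟨c₀, R₀, h₀⟩ := hL.exists_circumsphere hQ
  have hall : ∀ n : Fin d → ℤ, r ^ 2 ≤ value Q (toReal n - c) := by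
    intro n
    by_cases hn : n ∈ V
    · exact (hin n hn).ge
    · exact (hout n hn).le
  have hbx := hL.isBary x
  have h1 := sum_mul_value_sub Q Finset.univ hbx.1 hbx.2 c
  have h2 : r ^ 2 ≤ ∑ j, bary L x j * value Q (toReal (L j) - c) := by
    calc r ^ 2 = ∑ j, bary L x j * r ^ 2 := by rw [← Finset.sum_mul, hbx.1, one_mul]
      _ ≤ _ := Finset.sum_le_sum fun j _ => mul_le_mul_of_nonneg_left (hall _) (hb j)
  have h3 := hL.power_eq Q hbx
  have h4 := sum_mul_value_sub Q V hw hx.symm c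
  have h5 := sum_mul_value_sub Q V hw hx.symm c₀
  have h6 : ∑ v ∈ V, (V.card : ℝ)⁻¹ * value Q (toReal v - c) = r ^ 2 := by
    rw [Finset.sum_congr rfl fun v hv => by rw [hin v hv], ← Finset.sum_mul, hw, one_mul]
  -- Emptiness of the sphere of `V` makes the moment of `V` about `x` at most that of `L`, so the
  -- mean power of `V` with respect to `L` is nonpositive. Each of these powers is nonnegative, so
  -- all vanish.
  have h7 : ∑ v ∈ V, (V.card : ℝ)⁻¹ * power Q L (toReal v) ≤ 0 := by
    simp only [h₀, mul_sub, Finset.sum_sub_distrib, ← Finset.sum_mul, hw, one_mul]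
    have := h₀ x
    linarith
  have hpn := fun v => T.power_nonneg hQ hreg k t v
  have h8 : ∀ v ∈ V, power Q L (toReal v) = 0 := by
    have h9 := (Finset.sum_eq_zero_iff_of_nonneg (s := V)
      (f := fun v => (V.card : ℝ)⁻¹ * power Q L (toReal v))
      fun v _ => mul_nonneg (inv_nonneg.2 hcard.le) (hpn v)).1
      (le_antisymm h7 (Finset.sum_nonneg fun v _ => mul_nonneg (inv_nonneg.2 hcard.le) (hpn v)))
    intro v hv
    exact (mul_eq_zero.1 (h9 v hv)).resolve_left (inv_ne_zero hcard.ne')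
  have hVL : ∀ v ∈ V, ∃ j, L j = v := fun v hv =>
    T.exists_eq_of_power_eq_zero hQ hreg (h8 v hv)
  have himage : L '' ((Finset.univ.filter fun j => L j ∈ V : Finset (Fin (d + 1))) : Set _) =
      (V : Set (Fin d → ℤ)) := by
    ext v
    simp only [Finset.coe_filter, Finset.mem_univ, true_and, Set.mem_image, Set.mem_ofPred_eq,
      Finset.mem_coe]
    refine ⟨?_, fun hv => ?_⟩
    · rintro ⟨j, hj, rfl⟩
      exact hj
    · obtain ⟨j, rfl⟩ := hVL v hv
      exact ⟨j, hv, rfl⟩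
  refine ⟨k, t, Finset.univ.filter fun j => L j ∈ V, ?_, by rw [himage]⟩
  obtain ⟨v, hv⟩ := hV
  obtain ⟨j, rfl⟩ := hVL v hv
  exact ⟨j, by simpa using hv⟩

/-- The Delone subdivision of a regular form consists of the faces of the cells. -/
theorem deloneSubdivision_eq [Finite ι] [Nonempty ι] {Q : quadForms d} (hQ : Q ∈ pqf d)
    (hreg : T.IsRegular Q) :
    deloneSubdivision Q = {D | ∃ k t, ∃ J : Finset (Fin (d + 1)), J.Nonempty ∧
      D = convexHull ℝ (toReal '' (T.cell k t '' (J : Set (Fin (d + 1)))))} := by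
  ext D
  refine ⟨T.exists_face_of_isDelonePolytope hQ hreg, ?_⟩
  rintro ⟨k, t, J, hJ, rfl⟩
  exact T.isDelonePolytope_face hQ hreg k t hJ

/-- The description in `deloneSubdivision_eq` does not depend on `Q`, and regular PQFs form a
neighbourhood of `Q`. -/
theorem mem_interior_secondaryCone [Finite ι] [Nonempty ι] {Q : quadForms d} (hQ : Q ∈ pqf d)
    (hreg : T.IsRegular Q) : Q ∈ interior (secondaryCone (deloneSubdivision Q)) := by
  rw [mem_interior_iff_mem_nhds]
  filter_upwards [isOpen_pqf.mem_nhds hQ, T.eventually_isRegular hreg] with Q' hQ' hreg'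
  exact ⟨hQ', by rw [T.deloneSubdivision_eq hQ' hreg', T.deloneSubdivision_eq hQ hreg]⟩

end PeriodicTriangulation

/-! ### The inhomogeneous minimum -/

section InhomMin

variable {d : ℕ}

theorem bddBelow_value_sub {Q : quadForms d} (hQ : Q ∈ pqf d) (x : Fin d → ℝ) :
    BddBelow (Set.range fun v : Fin d → ℤ => value Q (x - toReal v)) :=
  ⟨0, by rintro _ ⟨v, rfl⟩; exact value_nonneg hQ _⟩

/-- Rounding down leaves coordinates in `[0, 1)`. Without this bound the real supremum would take a
default value. -/
theorem bddAbove_iInf_value_sub {Q : quadForms d} (hQ : Q ∈ pqf d) :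
    BddAbove (Set.range fun x : Fin d → ℝ => ⨅ v : Fin d → ℤ, value Q (x - toReal v)) := by
  refine ⟨∑ i, ∑ j, |(Q : Matrix (Fin d) (Fin d) ℝ) i j|, ?_⟩
  rintro _ ⟨x, rfl⟩
  refine (ciInf_le (bddBelow_value_sub hQ x) fun i => ⌊x i⌋).trans ?_
  rw [value_eq_sum]
  refine Finset.sum_le_sum fun i _ => Finset.sum_le_sum fun j _ => ?_
  refine (le_abs_self _).trans ?_
  have hfr : ∀ i, |(x - toReal fun i => ⌊x i⌋) i| ≤ 1 := fun i => by
    have : (x - toReal fun i => ⌊x i⌋) i = Int.fract (x i) := rfl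
    rw [this, abs_of_nonneg (Int.fract_nonneg _)]
    exact (Int.fract_lt_one _).le
  rw [abs_mul, abs_mul, mul_left_comm]
  exact mul_le_of_le_one_right (abs_nonneg _) (mul_le_one₀ (hfr i) (abs_nonneg _) (hfr j))

theorem inhomMin_le {Q : quadForms d} (hQ : Q ∈ pqf d) {B : ℝ}
    (h : ∀ x : Fin d → ℝ, ∃ v : Fin d → ℤ, value Q (x - toReal v) ≤ B) : inhomMin Q ≤ B := by
  refine ciSup_le fun x => ?_
  obtain ⟨v, hv⟩ := h x
  exact (ciInf_le (bddBelow_value_sub hQ x) v).trans hv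

theorem le_inhomMin {Q : quadForms d} (hQ : Q ∈ pqf d) {B : ℝ} (x : Fin d → ℝ)
    (h : ∀ v : Fin d → ℤ, B ≤ value Q (x - toReal v)) : B ≤ inhomMin Q :=
  (le_ciInf h).trans (le_ciSup (bddAbove_iInf_value_sub hQ) x)

namespace PeriodicTriangulation

variable {ι : Type*} (T : PeriodicTriangulation d ι)

/-- The weighted moments of the simplices bound the inhomogeneous minimum from below. -/
theorem sum_mul_value_sub_le_inhomMin [Finite ι] [Nonempty ι] {Q : quadForms d} (hQ : Q ∈ pqf d)
    (hreg : T.IsRegular Q) (k : ι) {x : Fin d → ℝ} {β : Fin (d + 1) → ℝ}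
    (h : IsBary (T.simplex k) x β) :
    ∑ j, β j * value Q (toReal (T.simplex k j) - x) ≤ inhomMin Q := by
  obtain ⟨c, R, hc⟩ := (T.unimodular k).exists_circumsphere hQ
  -- The circumcentre is the test point: emptiness of the circumsphere keeps every lattice point at
  -- squared distance at least `R`.
  have h1 : R ≤ inhomMin Q := by
    refine le_inhomMin hQ c fun v => ?_
    have h2 := T.power_nonneg hQ hreg k 0 v
    rw [T.power_cell, show toReal (0 : Fin d → ℤ) = 0 by ext; simp [toReal], sub_zero, hc,
      value_sub_comm] at h2
    linarith
  have h2 := (T.unimodular k).power_eq Q h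
  rw [hc] at h2
  have := value_nonneg hQ (x - c)
  linarith

/-- A common bound for the circumradii bounds the inhomogeneous minimum. -/
theorem inhomMin_le [Finite ι] [Nonempty ι] {Q : quadForms d} (hQ : Q ∈ pqf d)
    (hreg : T.IsRegular Q) {B : ℝ} (c : ι → Fin d → ℝ) (R : ι → ℝ)
    (hc : ∀ k j, value Q (toReal (T.simplex k j) - c k) = R k) (hR : ∀ k, R k ≤ B) :
    inhomMin Q ≤ B := by
  refine LatticeCovering.inhomMin_le hQ fun x => ?_
  obtain ⟨k, t, hb⟩ := T.exists_bary_nonneg hQ hreg x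
  -- If all lattice points were farther than `B` from `x`, the weighted moment of the cell about `x`
  -- would exceed `B`; but it equals the squared circumradius minus a nonnegative term.
  by_contra! hcon
  have hx := (T.unimodular_cell k t).isBary x
  have h1 := (T.unimodular_cell k t).power_eq Q hx
  rw [T.power_cell, (T.unimodular k).power_eq_value_sub (hc k)] at h1
  have h2 : B ≤ ∑ j, bary (T.cell k t) x j * value Q (toReal (T.cell k t j) - x) := by
    calc B = ∑ j, bary (T.cell k t) x j * B := by rw [← Finset.sum_mul, hx.1, one_mul]
      _ ≤ _ := Finset.sum_le_sum fun j _ => mul_le_mul_of_nonneg_left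
        (by rw [value_sub_comm]; exact (hcon _).le) (hb j)
  obtain ⟨j, hj⟩ : ∃ j, 0 < bary (T.cell k t) x j := by
    by_contra! h0
    have := Finset.sum_nonpos fun j (_ : j ∈ Finset.univ) => h0 j
    linarith [hx.1]
  have h3 : B < ∑ j, bary (T.cell k t) x j * value Q (toReal (T.cell k t j) - x) := by
    calc B = ∑ j, bary (T.cell k t) x j * B := by rw [← Finset.sum_mul, hx.1, one_mul]
      _ < _ := Finset.sum_lt_sum (fun j _ => mul_le_mul_of_nonneg_left
          (by rw [value_sub_comm]; exact (hcon _).le) (hb j))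
        ⟨j, Finset.mem_univ j, mul_lt_mul_of_pos_left
          (by rw [value_sub_comm]; exact hcon _) hj⟩
  have := value_nonneg hQ (x - toReal t - c k)
  linarith [hR k]

end PeriodicTriangulation

end InhomMin

/-! ### Determinants and traces -/

section DetTrace

variable {n : Type*} [Fintype n] [DecidableEq n]

/-- AM-GM for the eigenvalues. -/
theorem det_le_trace_div_card_pow [Nonempty n] {A : Matrix n n ℝ} (hA : A.PosSemidef) :
    A.det ≤ (A.trace / Fintype.card n) ^ Fintype.card n := by
  have hn : (0 : ℝ) < Fintype.card n := by exact_mod_cast Fintype.card_pos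
  have h0 : ∀ i ∈ Finset.univ, 0 ≤ hA.1.eigenvalues i := fun i _ => hA.eigenvalues_nonneg i
  have h := Real.geom_mean_le_arith_mean Finset.univ (fun _ => (1 : ℝ)) hA.1.eigenvalues
    (fun _ _ => zero_le_one) (by simpa using hn) h0
  simp only [Real.rpow_one, Finset.sum_const, Finset.card_univ, nsmul_eq_mul, mul_one,
    one_mul] at h
  have hdet : A.det = ∏ i, hA.1.eigenvalues i := by
    simpa using hA.1.det_eq_prod_eigenvalues
  have htr : A.trace = ∑ i, hA.1.eigenvalues i := by
    simpa using hA.1.trace_eq_sum_eigenvalues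
  rw [← hdet, ← htr] at h
  have hd : 0 ≤ A.det := by rw [hdet]; exact Finset.prod_nonneg h0
  calc A.det = (A.det ^ ((Fintype.card n : ℝ)⁻¹)) ^ Fintype.card n :=
        (Real.rpow_inv_natCast_pow hd Fintype.card_ne_zero).symm
    _ ≤ _ := pow_le_pow_left₀ (Real.rpow_nonneg hd _) h _

open scoped MatrixOrder in
theorem det_mul_det_le_trace_mul_div_card_pow [Nonempty n] {A B : Matrix n n ℝ}
    (hA : A.PosSemidef) (hB : B.PosSemidef) :
    B.det * A.det ≤ ((B * A).trace / Fintype.card n) ^ Fintype.card n := by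
  obtain ⟨C, rfl⟩ : ∃ C : Matrix n n ℝ, B = C.conjTranspose * C :=
    CStarAlgebra.nonneg_iff_eq_star_mul_self.mp hB.nonneg
  have h := det_le_trace_div_card_pow (hA.mul_mul_conjTranspose_same C)
  rw [Matrix.det_mul, Matrix.det_mul] at h
  rw [Matrix.det_mul, Matrix.mul_assoc, Matrix.trace_mul_comm]
  calc _ = C.det * A.det * C.conjTranspose.det := by ring
    _ ≤ _ := h

/-- Rank one update of a scalar matrix. -/
theorem det_smul_one_add_smul_ones {d : ℕ} (a b : ℝ) (ha : a ≠ 0) :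
    (a • (1 : Matrix (Fin d) (Fin d) ℝ) + b • Matrix.of fun _ _ => (1 : ℝ)).det =
      a ^ d * (1 + d * b / a) := by
  have h : a • (1 : Matrix (Fin d) (Fin d) ℝ) + b • Matrix.of (fun _ _ => (1 : ℝ)) =
      a • (1 + Matrix.replicateCol Unit (fun _ : Fin d => b / a) *
        Matrix.replicateRow Unit fun _ : Fin d => (1 : ℝ)) := by
    ext i j
    simp [Matrix.mul_apply, Matrix.one_apply, mul_add, mul_div_cancel₀ _ ha]
  rw [h, Matrix.det_smul, Matrix.det_one_add_replicateCol_mul_replicateRow]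
  simp [dotProduct, mul_div_assoc]

end DetTrace

/-! ### Averages over coordinate permutations -/

section PermAverage

variable {ι : Type*} [Fintype ι] [DecidableEq ι]

/-- By transitivity the sum over `σ` does not depend on `a`; sum over all `a`. -/
theorem sum_perm_mul_sum (f : ι → ℝ) (a : ι) :
    (Fintype.card ι : ℝ) * ∑ σ : Equiv.Perm ι, f (σ a) = (Fintype.card ι).factorial * ∑ i, f i := by
  have h : ∀ b, ∑ σ : Equiv.Perm ι, f (σ b) = ∑ σ : Equiv.Perm ι, f (σ a) := fun b => by
    rw [← Equiv.sum_comp (Equiv.mulRight (Equiv.swap a b))]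
    simp
  calc _ = ∑ b, ∑ σ : Equiv.Perm ι, f (σ b) := by simp [h]
    _ = ∑ σ : Equiv.Perm ι, ∑ b, f (σ b) := Finset.sum_comm
    _ = _ := by simp [Equiv.sum_comp, Fintype.card_perm]

/-- By 2-transitivity the sum is the same for all `b ≠ a`; summing over every `b`, with the diagonal
term split off, evaluates it. -/
theorem sum_perm_mul_apply (y : ι → ℝ) {a b : ι} (hab : a ≠ b) :
    (Fintype.card ι : ℝ) * (Fintype.card ι - 1) * ∑ σ : Equiv.Perm ι, y (σ a) * y (σ b) =
      (Fintype.card ι).factorial * ((∑ i, y i) ^ 2 - ∑ i, y i ^ 2) := by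
  have h : ∀ b' ∈ Finset.univ.erase a, ∑ σ : Equiv.Perm ι, y (σ a) * y (σ b') =
      ∑ σ : Equiv.Perm ι, y (σ a) * y (σ b) := fun b' hb' => by
    rw [← Equiv.sum_comp (Equiv.mulRight (Equiv.swap b b'))]
    simp [Equiv.swap_apply_of_ne_of_ne hab (Finset.ne_of_mem_erase hb').symm]
  have h1 : ∑ b', ∑ σ : Equiv.Perm ι, y (σ a) * y (σ b') =
      (∑ i, y i) * ∑ σ : Equiv.Perm ι, y (σ a) := by
    rw [Finset.sum_comm, Finset.mul_sum]
    refine Finset.sum_congr rfl fun σ _ => ?_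
    rw [← Finset.mul_sum, Equiv.sum_comp σ y, mul_comm]
  have hcard : ((Finset.univ.erase a).card : ℝ) = Fintype.card ι - 1 := by
    rw [Finset.card_erase_of_mem (Finset.mem_univ a), Finset.card_univ,
      Nat.cast_sub (Fintype.card_pos_iff.2 ⟨a⟩), Nat.cast_one]
  rw [← Finset.add_sum_erase _ _ (Finset.mem_univ a), Finset.sum_congr rfl h,
    Finset.sum_const, nsmul_eq_mul, hcard] at h1
  have h2 := sum_perm_mul_sum y a
  have h3 := sum_perm_mul_sum (fun i => y i ^ 2) a
  simp only [← sq] at h1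
  linear_combination (Fintype.card ι : ℝ) * h1 - h3 + (∑ i, y i) * h2

/-- Averaging retains only two linear functionals of `A`, its trace and its total sum. -/
theorem sum_perm_dotProduct_mulVec (A : Matrix ι ι ℝ) (y : ι → ℝ) :
    (Fintype.card ι : ℝ) * (Fintype.card ι - 1) *
        ∑ σ : Equiv.Perm ι, (y ∘ σ) ⬝ᵥ (A.mulVec (y ∘ σ)) =
      (Fintype.card ι).factorial * ((Fintype.card ι * ∑ i, y i ^ 2 - (∑ i, y i) ^ 2) * A.trace +
        ((∑ i, y i) ^ 2 - ∑ i, y i ^ 2) * ∑ i, ∑ j, A i j) := by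
  have h : ∀ a b, (Fintype.card ι : ℝ) * (Fintype.card ι - 1) *
      ∑ σ : Equiv.Perm ι, y (σ a) * y (σ b) = (Fintype.card ι).factorial *
        (((∑ i, y i) ^ 2 - ∑ i, y i ^ 2) + if a = b then
          Fintype.card ι * ∑ i, y i ^ 2 - (∑ i, y i) ^ 2 else 0) := by
    intro a b
    split_ifs with hab
    · subst hab
      have := sum_perm_mul_sum (fun i => y i ^ 2) a
      simp only [← sq]
      linear_combination (Fintype.card ι - 1 : ℝ) * this
    · rw [sum_perm_mul_apply y hab, add_zero]
  have h2 : ∑ σ : Equiv.Perm ι, (y ∘ σ) ⬝ᵥ (A.mulVec (y ∘ σ)) =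
      ∑ a, ∑ b, A a b * ∑ σ : Equiv.Perm ι, y (σ a) * y (σ b) := by
    simp only [dotProduct, Matrix.mulVec, Finset.mul_sum, Function.comp_apply]
    rw [Finset.sum_comm]
    refine Finset.sum_congr rfl fun a _ => ?_
    rw [Finset.sum_comm]
    exact Finset.sum_congr rfl fun b _ => Finset.sum_congr rfl fun σ _ => by ring
  calc _ = ∑ a, ∑ b, A a b * ((Fintype.card ι : ℝ) * (Fintype.card ι - 1) *
        ∑ σ : Equiv.Perm ι, y (σ a) * y (σ b)) := by
        rw [h2, Finset.mul_sum]
        refine Finset.sum_congr rfl fun a _ => ?_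
        rw [Finset.mul_sum]
        exact Finset.sum_congr rfl fun b _ => mul_left_comm _ _ _
    _ = _ := by
        simp only [h, mul_add, Finset.sum_add_distrib, mul_ite, mul_zero, Finset.sum_ite_eq,
          Finset.mem_univ, if_true, ← Finset.sum_mul, Matrix.trace, Matrix.diag_apply]
        ring

end PermAverage

/-! ### Coordinates in which the form `Qc7` is invariant under all permutations -/

/-- The change from lattice coordinates to the permuted coordinates. -/
def coordMatrix : Matrix (Fin 7) (Fin 7) ℤ :=
  !![3, 0, 0, 0, 0, 0, 1;
     0, 3, 0, 0, 0, 0, 1;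
     0, 0, 3, 0, 0, 0, 1;
     0, 0, 0, 3, 0, 0, 1;
     0, 0, 0, 0, 3, 0, 1;
     0, 0, 0, 0, 0, 3, -2;
     0, 0, 0, 0, 0, 0, 1]

/-- The change of coordinates over the reals. -/
def realCoordMatrix : Matrix (Fin 7) (Fin 7) ℝ := coordMatrix.map (Int.castRingHom ℝ)

/-- Nine times the form in the permuted coordinates. -/
def permForm {R : Type*} [CommRing R] (y : Fin 7 → R) : R := 11 * ∑ i, y i ^ 2 + (∑ i, y i) ^ 2

/-- The lattice in the permuted coordinates. -/
def IsCongr (y : Fin 7 → ℤ) : Prop := ∀ i j, 3 ∣ y i - y j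

/-- The change from permuted coordinates to lattice coordinates. -/
def ofCoord (y : Fin 7 → ℤ) : Fin 7 → ℤ :=
  ![(y 0 - y 6) / 3, (y 1 - y 6) / 3, (y 2 - y 6) / 3, (y 3 - y 6) / 3, (y 4 - y 6) / 3,
    (y 5 + 2 * y 6) / 3, y 6]

instance (y : Fin 7 → ℤ) : Decidable (IsCongr y) :=
  inferInstanceAs (Decidable (∀ i j, 3 ∣ y i - y j))

theorem IsCongr.comp {y : Fin 7 → ℤ} (h : IsCongr y) (σ : Fin 7 → Fin 7) : IsCongr (y ∘ σ) :=
  fun i j => h (σ i) (σ j)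

theorem IsCongr.add {y z : Fin 7 → ℤ} (hy : IsCongr y) (hz : IsCongr z) : IsCongr (y + z) :=
  fun i j => by
    have := dvd_add (hy i j) (hz i j)
    simpa [add_sub_add_comm] using this

theorem coordMatrix_mulVec (n : Fin 7 → ℤ) :
    coordMatrix.mulVec n = ![3 * n 0 + n 6, 3 * n 1 + n 6, 3 * n 2 + n 6, 3 * n 3 + n 6,
      3 * n 4 + n 6, 3 * n 5 - 2 * n 6, n 6] := by
  ext i
  fin_cases i <;> simp [coordMatrix, Matrix.mulVec, dotProduct, Fin.sum_univ_succ] <;> ring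

theorem realCoordMatrix_mulVec (x : Fin 7 → ℝ) :
    realCoordMatrix.mulVec x = ![3 * x 0 + x 6, 3 * x 1 + x 6, 3 * x 2 + x 6, 3 * x 3 + x 6,
      3 * x 4 + x 6, 3 * x 5 - 2 * x 6, x 6] := by
  ext i
  fin_cases i <;>
    simp [realCoordMatrix, coordMatrix, Matrix.mulVec, dotProduct, Fin.sum_univ_succ] <;> ring

theorem coordMatrix_mulVec_injective : Function.Injective coordMatrix.mulVec := by
  intro m n h
  simp only [coordMatrix_mulVec] at h
  have := fun i => congrFun h i
  simp only [Fin.forall_fin_succ] at this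
  ext i
  fin_cases i <;> simp at this ⊢ <;> omega

/-- All entries are congruent to `n 6` modulo 3, since `-2 ≡ 1`. -/
theorem isCongr_coordMatrix_mulVec (n : Fin 7 → ℤ) : IsCongr (coordMatrix.mulVec n) := by
  have h : ∀ i, 3 ∣ coordMatrix.mulVec n i - n 6 := by
    intro i
    rw [coordMatrix_mulVec]
    fin_cases i <;> simp <;> omega
  intro i j
  have := dvd_sub (h i) (h j)
  simpa using this

/-- On congruent vectors the integer divisions in `ofCoord` are exact. -/
theorem coordMatrix_mulVec_ofCoord {y : Fin 7 → ℤ} (h : IsCongr y) :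
    coordMatrix.mulVec (ofCoord y) = y := by
  rw [coordMatrix_mulVec]
  have := fun i => h i 6
  simp only [Fin.forall_fin_succ] at this
  ext i
  fin_cases i <;> simp [ofCoord] at this ⊢ <;> omega

theorem ofCoord_add {y z : Fin 7 → ℤ} (hy : IsCongr y) (hz : IsCongr z) :
    ofCoord (y + z) = ofCoord y + ofCoord z := by
  apply coordMatrix_mulVec_injective
  rw [Matrix.mulVec_add, coordMatrix_mulVec_ofCoord hy, coordMatrix_mulVec_ofCoord hz,
    coordMatrix_mulVec_ofCoord (hy.add hz)]

theorem realCoordMatrix_mulVec_toReal (n : Fin 7 → ℤ) :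
    realCoordMatrix.mulVec (toReal n) = toReal (coordMatrix.mulVec n) :=
  funext fun i => (RingHom.map_mulVec (Int.castRingHom ℝ) coordMatrix n i).symm

theorem det_realCoordMatrix : realCoordMatrix.det = 3 ^ 6 := by
  rw [Matrix.det_of_isUpperTriangular]
  · simp [Fin.prod_univ_succ, realCoordMatrix, coordMatrix]
    norm_num
  · intro i j hij
    fin_cases i <;> fin_cases j <;> first
      | exact absurd hij (by decide)
      | simp [realCoordMatrix, coordMatrix]

theorem isUnit_det_realCoordMatrix : IsUnit realCoordMatrix.det := by
  rw [det_realCoordMatrix]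
  exact isUnit_iff_ne_zero.2 (by norm_num)

theorem value_Qc7 (x : Fin 7 → ℝ) : value Qc7 x = permForm (realCoordMatrix.mulVec x) / 9 := by
  rw [realCoordMatrix_mulVec]
  simp [value, Qc7, permForm, Matrix.mulVec, dotProduct, Fin.sum_univ_succ]
  ring

theorem permForm_comp {R : Type*} [CommRing R] (y : Fin 7 → R) (σ : Equiv.Perm (Fin 7)) :
    permForm (y ∘ σ) = permForm y := by
  simp [permForm, Equiv.sum_comp σ y, Equiv.sum_comp σ fun i => y i ^ 2]

theorem permForm_toReal (y : Fin 7 → ℤ) : permForm (toReal y) = (permForm y : ℤ) := by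
  simp [permForm, toReal]

theorem Qc7_mem_pqf : Qc7 ∈ pqf 7 := by
  refine mem_pqf_iff.2 fun x hx => ?_
  have hy : realCoordMatrix.mulVec x ≠ 0 := fun h => hx <| by
    refine Matrix.mulVec_injective_iff_isUnit.2
      ((Matrix.isUnit_iff_isUnit_det _).2 isUnit_det_realCoordMatrix) ?_
    rw [h, Matrix.mulVec_zero]
  obtain ⟨i, hi⟩ := Function.ne_iff.1 hy
  have : 0 < ∑ i, realCoordMatrix.mulVec x i ^ 2 :=
    Finset.sum_pos' (fun i _ => sq_nonneg _) ⟨i, Finset.mem_univ i, by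
      have : realCoordMatrix.mulVec x i ≠ 0 := hi
      positivity⟩
  rw [value_Qc7, permForm]
  positivity

/-! ### The Delone triangulation of `Qc7` -/

/-- Representatives of the Delone simplices, in the permuted coordinates. -/
def rep : Fin 4 → Fin 8 → Fin 7 → ℤ :=
  ![![![0, 0, 0, 0, 0, 0, 0],
      ![0, 0, 0, 0, 0, 0, 3],
      ![0, 0, 0, 0, 0, 3, 0],
      ![-2, 1, 1, 1, 1, 1, 1],
      ![-2, -2, 1, 1, 1, 1, 1],
      ![-1, -1, -1, -1, 2, 2, 2],
      ![-1, -1, -1, 2, -1, 2, 2],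
      ![-1, -1, -1, 2, 2, 2, 2]],
    ![![0, 0, 0, 0, 0, 3, 3],
      ![0, 0, 0, 0, 0, 0, 3],
      ![0, 0, 0, 0, 0, 3, 0],
      ![-2, 1, 1, 1, 1, 1, 1],
      ![-2, -2, 1, 1, 1, 1, 1],
      ![-1, -1, -1, -1, 2, 2, 2],
      ![-1, -1, -1, 2, -1, 2, 2],
      ![-1, -1, -1, 2, 2, 2, 2]],
    ![![0, 0, 0, 0, 0, 0, 0],
      ![0, 0, 0, 0, 0, 0, 3],
      ![0, 0, 0, 0, 0, 3, 0],
      ![-2, 1, 1, 1, 1, 1, 1],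
      ![-2, -2, 1, 1, 1, 1, 1],
      ![1, -2, 1, 1, 1, 1, 1],
      ![-1, -1, -1, 2, -1, 2, 2],
      ![-1, -1, -1, 2, 2, 2, 2]],
    ![![0, 0, 0, 0, 0, 3, 3],
      ![0, 0, 0, 0, 0, 0, 3],
      ![0, 0, 0, 0, 0, 3, 0],
      ![-2, 1, 1, 1, 1, 1, 1],
      ![-2, -2, 1, 1, 1, 1, 1],
      ![-1, -1, -1, -1, 2, 2, 2],
      ![-1, -1, -1, 2, -1, 2, 2],
      ![-1, -1, -1, -1, -1, 2, 2]]]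

/-- Coefficients expressing the origin and the lattice basis through the vertices. -/
def repCoeff : Fin 4 → Fin 8 → Fin 8 → ℤ :=
  ![![![1, 0, 0, 0, 0, 0, 0, 0],
      ![0, 1, 1, -1, 0, -1, -1, 1],
      ![0, 0, 0, 1, -1, 0, 0, 0],
      ![-1, 1, 1, 0, 1, -1, -1, 0],
      ![0, 0, 0, 0, 0, -1, 0, 1],
      ![0, 0, 0, 0, 0, 0, -1, 1],
      ![-1, 0, 1, 0, 0, 0, 0, 0],
      ![0, 1, 0, 0, 0, -1, -1, 1]],
    ![![-1, 1, 1, 0, 0, 0, 0, 0],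
      ![0, 1, 1, -1, 0, -1, -1, 1],
      ![0, 0, 0, 1, -1, 0, 0, 0],
      ![1, 0, 0, 0, 1, -1, -1, 0],
      ![0, 0, 0, 0, 0, -1, 0, 1],
      ![0, 0, 0, 0, 0, 0, -1, 1],
      ![1, -1, 0, 0, 0, 0, 0, 0],
      ![0, 1, 0, 0, 0, -1, -1, 1]],
    ![![1, 0, 0, 0, 0, 0, 0, 0],
      ![0, 0, 0, 0, -1, 1, 0, 0],
      ![0, 0, 0, 1, -1, 0, 0, 0],
      ![-1, 0, 0, 1, 0, 1, 0, -1],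
      ![0, -1, -1, 1, -1, 1, 1, 0],
      ![0, 0, 0, 0, 0, 0, -1, 1],
      ![-1, 0, 1, 0, 0, 0, 0, 0],
      ![0, 0, -1, 1, -1, 1, 0, 0]],
    ![![-1, 1, 1, 0, 0, 0, 0, 0],
      ![0, 1, 1, -1, 0, 0, 0, -1],
      ![0, 0, 0, 1, -1, 0, 0, 0],
      ![1, 0, 0, 0, 1, -1, -1, 0],
      ![0, 0, 0, 0, 0, 0, 1, -1],
      ![0, 0, 0, 0, 0, 1, 0, -1],
      ![1, -1, 0, 0, 0, 0, 0, 0],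
      ![0, 1, 0, 0, 0, 0, 0, -1]]]

/-- The representatives of the neighbouring simplices. -/
def neighborRep : Fin 4 → Fin 8 → Fin 4 :=
  ![![1, 1, 1, 0, 0, 2, 2, 2],
    ![0, 1, 1, 1, 1, 0, 0, 3],
    ![0, 2, 2, 0, 3, 0, 2, 2],
    ![2, 3, 3, 3, 3, 3, 3, 1]]

/-- A permutation of the coordinates relating neighbouring simplices. -/
def coordCycle : Equiv.Perm (Fin 7) :=
  ⟨![2, 4, 3, 5, 6, 0, 1], ![5, 6, 0, 2, 1, 3, 4], by decide, by decide⟩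

/-- The permutations carrying the representatives to the neighbouring simplices. -/
def neighborPerm : Fin 4 → Fin 8 → Equiv.Perm (Fin 7) :=
  ![![1, Equiv.swap 0 1 * coordCycle, coordCycle, Equiv.swap 0 1, Equiv.swap 1 2, 1,
      Equiv.swap 3 4, coordCycle],
    ![1, Equiv.swap 0 5, Equiv.swap 0 6, Equiv.swap 0 1, Equiv.swap 1 2, coordCycle⁻¹,
      Equiv.swap 1 2 * coordCycle⁻¹, 1],
    ![coordCycle⁻¹, Equiv.swap 3 6, Equiv.swap 3 5, Equiv.swap 0 1, coordCycle⁻¹, 1,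
      Equiv.swap 3 4, Equiv.swap 2 4],
    ![coordCycle, Equiv.swap 0 5, Equiv.swap 0 6, Equiv.swap 0 1, Equiv.swap 1 2, Equiv.swap 2 4,
      Equiv.swap 2 3, 1]]

/-- The translations carrying the permuted representatives to the neighbouring simplices. -/
def neighborShift : Fin 4 → Fin 8 → Fin 7 → ℤ :=
  ![![![0, 0, 0, 0, 0, 0, 0],
      ![-1, -1, -1, -1, -1, 2, 2],
      ![-1, -1, -1, -1, -1, 2, 2],
      ![0, 0, 0, 0, 0, 0, 0],
      ![0, 0, 0, 0, 0, 0, 0],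
      ![0, 0, 0, 0, 0, 0, 0],
      ![0, 0, 0, 0, 0, 0, 0],
      ![-1, -1, -1, -1, -1, 2, 2]],
    ![![0, 0, 0, 0, 0, 0, 0],
      ![-3, 0, 0, 0, 0, 3, 0],
      ![-3, 0, 0, 0, 0, 0, 3],
      ![0, 0, 0, 0, 0, 0, 0],
      ![0, 0, 0, 0, 0, 0, 0],
      ![-2, -2, 1, 1, 1, 1, 1],
      ![-2, -2, 1, 1, 1, 1, 1],
      ![0, 0, 0, 0, 0, 0, 0]],
    ![![-2, -2, 1, 1, 1, 1, 1],
      ![0, 0, 0, 0, 0, 0, 0],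
      ![0, 0, 0, 0, 0, 0, 0],
      ![0, 0, 0, 0, 0, 0, 0],
      ![-2, -2, 1, 1, 1, 1, 1],
      ![0, 0, 0, 0, 0, 0, 0],
      ![0, 0, 0, 0, 0, 0, 0],
      ![0, 0, 0, 0, 0, 0, 0]],
    ![![-1, -1, -1, -1, -1, 2, 2],
      ![-3, 0, 0, 0, 0, 3, 0],
      ![-3, 0, 0, 0, 0, 0, 3],
      ![0, 0, 0, 0, 0, 0, 0],
      ![0, 0, 0, 0, 0, 0, 0],
      ![0, 0, 0, 0, 0, 0, 0],
      ![0, 0, 0, 0, 0, 0, 0],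
      ![0, 0, 0, 0, 0, 0, 0]]]

/-- The correspondence of the vertices of neighbouring simplices. -/
def neighborVertex : Fin 4 → Fin 8 → Fin 8 → Fin 8 :=
  ![![![0, 1, 2, 3, 4, 5, 6, 7], ![4, 5, 3, 7, 6, 1, 2, 0], ![4, 3, 5, 7, 6, 1, 2, 0], ![0, 1, 2,
      3, 4, 5, 6, 7], ![0, 1, 2, 3, 4, 5, 6, 7], ![0, 1, 2, 3, 4, 5, 6, 7], ![0, 1, 2, 3, 4, 6, 5,
      7], ![4, 3, 5, 7, 6, 1, 2, 0]],
    ![![0, 1, 2, 3, 4, 5, 6, 7], ![0, 1, 2, 3, 4, 5, 6, 7], ![0, 1, 2, 3, 4, 5, 6, 7], ![0, 1, 2,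
      3, 4, 5, 6, 7], ![0, 1, 2, 3, 4, 5, 6, 7], ![7, 5, 6, 1, 0, 2, 4, 3], ![7, 5, 6, 1, 0, 4, 2,
      3], ![0, 1, 2, 3, 4, 5, 6, 7]],
    ![![7, 5, 6, 1, 0, 2, 4, 3], ![0, 1, 2, 3, 4, 5, 6, 7], ![0, 1, 2, 3, 4, 5, 6, 7], ![0, 1, 2,
      5, 4, 3, 6, 7], ![7, 5, 6, 1, 0, 2, 4, 3], ![0, 1, 2, 3, 4, 5, 6, 7], ![0, 1, 2, 3, 4, 5, 6,
      7], ![0, 1, 2, 3, 4, 5, 6, 7]],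
    ![![4, 3, 5, 7, 6, 1, 2, 0], ![0, 1, 2, 3, 4, 5, 6, 7], ![0, 1, 2, 3, 4, 5, 6, 7], ![0, 1, 2,
      3, 4, 5, 6, 7], ![0, 1, 2, 3, 4, 5, 6, 7], ![0, 1, 2, 3, 4, 5, 6, 7], ![0, 1, 2, 3, 4, 5, 6,
      7], ![0, 1, 2, 3, 4, 5, 6, 7]]]

/-- The lattice points completing the facets to the neighbouring simplices. -/
def apexRep (k : Fin 4) (i : Fin 8) : Fin 7 → ℤ :=
  rep (neighborRep k i) (neighborVertex k i i) ∘ neighborPerm k i + neighborShift k i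

/-- Barycentric coordinates of the points `apexRep`. -/
def apexCoeff : Fin 4 → Fin 8 → Fin 8 → ℤ :=
  ![![![-1, 1, 1, 0, 0, 0, 0, 0],
      ![1, -1, -1, 1, -1, 1, 1, 0],
      ![1, -1, -1, 1, -1, 1, 1, 0],
      ![0, 1, 1, -1, 1, -1, -1, 1],
      ![1, -1, -1, 1, -1, 1, 1, 0],
      ![0, 1, 1, -1, 1, -1, -1, 1],
      ![0, 1, 1, -1, 1, -1, -1, 1],
      ![0, 0, 0, 0, 0, 1, 1, -1]],
    ![![-1, 1, 1, 0, 0, 0, 0, 0],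
      ![1, -1, -1, 1, 0, 1, 1, -1],
      ![1, -1, -1, 1, 0, 1, 1, -1],
      ![0, 1, 1, -1, 1, -1, -1, 1],
      ![-1, 0, 0, 1, -1, 1, 1, 0],
      ![0, 1, 1, -1, 1, -1, -1, 1],
      ![0, 1, 1, -1, 1, -1, -1, 1],
      ![0, 0, 0, 0, 0, 1, 1, -1]],
    ![![-1, 1, 1, 0, 0, 0, 0, 0],
      ![1, -1, -1, 1, -1, 1, 1, 0],
      ![1, -1, -1, 1, -1, 1, 1, 0],
      ![0, 1, 1, -1, 1, -1, -1, 1],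
      ![0, 0, 0, 1, -1, 1, 0, 0],
      ![0, 1, 1, -1, 1, -1, -1, 1],
      ![0, 1, 1, -1, 1, -1, -1, 1],
      ![-1, 0, 0, 1, 0, 1, 1, -1]],
    ![![-1, 1, 1, 0, 0, 0, 0, 0],
      ![1, -1, -1, 1, 0, 0, 0, 1],
      ![1, -1, -1, 1, 0, 0, 0, 1],
      ![0, 1, 1, -1, 1, 0, 0, -1],
      ![-1, 0, 0, 1, -1, 1, 1, 0],
      ![1, 0, 0, 0, 1, -1, -1, 1],
      ![1, 0, 0, 0, 1, -1, -1, 1],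
      ![0, 0, 0, 0, 0, 1, 1, -1]]]

/-- The circumcentres of the representatives, scaled by `22`. -/
def centerRep : Fin 4 → Fin 7 → ℤ :=
  ![![-17, -11, -5, 13, 13, 31, 31],
    ![-18, -12, 0, 12, 12, 36, 36],
    ![-12, -12, 0, 18, 12, 30, 30],
    ![-23, -11, 1, 7, 7, 37, 37]]

/-- Barycentric coordinates of the circumcentres, scaled by `22`. -/
def centerCoeff : Fin 4 → Fin 8 → ℤ :=
  ![![3, 3, 3, 2, 2, 3, 3, 3],
    ![2, 4, 4, 2, 4, 2, 2, 2],
    ![2, 4, 4, 2, 2, 2, 2, 4],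
    ![3, 2, 2, 4, 4, 2, 2, 3]]

/-! ### Finite verification of the simplex data -/

theorem isCongr_rep (k : Fin 4) (j : Fin 8) : IsCongr (rep k j) := by
  revert k j; decide +kernel

theorem isCongr_neighborShift (k : Fin 4) (i : Fin 8) : IsCongr (neighborShift k i) := by
  revert k i; decide +kernel

theorem isCongr_apexRep (k : Fin 4) (i : Fin 8) : IsCongr (apexRep k i) :=
  ((isCongr_rep _ _).comp _).add (isCongr_neighborShift k i)

/-- Row 0 represents the origin with coefficient sum 1, the other rows the basis vectors with sum 0;
together they certify unimodularity. -/
theorem sum_repCoeff (k : Fin 4) (i : Fin 8) :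
    ∑ j, repCoeff k i j = if i = 0 then 1 else 0 := by
  revert k i; decide +kernel

theorem sum_repCoeff_zero_smul_rep (k : Fin 4) : ∑ j, repCoeff k 0 j • rep k j = 0 := by
  revert k; decide +kernel

theorem sum_repCoeff_succ_smul_rep (k : Fin 4) (i : Fin 7) :
    ∑ j, repCoeff k i.succ j • rep k j = coordMatrix.col i := by
  revert k i; decide +kernel

theorem rep_eq_neighbor (k : Fin 4) (i j : Fin 8) (hj : j ≠ i) :
    rep (neighborRep k i) (neighborVertex k i j) ∘ neighborPerm k i + neighborShift k i =
      rep k j := by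
  revert k i j; decide +kernel

theorem sum_apexCoeff (k : Fin 4) (i : Fin 8) : ∑ j, apexCoeff k i j = 1 := by
  revert k i; decide +kernel

theorem sum_apexCoeff_smul_rep (k : Fin 4) (i : Fin 8) :
    ∑ j, apexCoeff k i j • rep k j = apexRep k i := by
  revert k i; decide +kernel

theorem apexCoeff_neg (k : Fin 4) (i : Fin 8) : apexCoeff k i i < 0 := by
  revert k i; decide +kernel

/-- By `IsUnimodular.power_eq` this is regularity at the facet, up to a negative factor. -/
theorem sum_apexCoeff_mul_permForm_neg (k : Fin 4) (i : Fin 8) :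
    ∑ j, apexCoeff k i j * permForm (rep k j - apexRep k i) < 0 := by
  revert k i; decide +kernel

/-- Equidistance of the vertices from the scaled centre; `32670 = 9 · 22² · 15/2`. -/
theorem permForm_rep_sub_centerRep (k : Fin 4) (j : Fin 8) :
    permForm (22 • rep k j - centerRep k) = permForm (22 • rep k 0 - centerRep k) ∧
      permForm (22 • rep k 0 - centerRep k) ≤ 32670 := by
  revert k j; decide +kernel

theorem sum_centerCoeff (k : Fin 4) : ∑ j, centerCoeff k j = 22 := by
  revert k; decide +kernel

theorem sum_centerCoeff_smul_rep (k : Fin 4) : ∑ j, centerCoeff k j • rep k j = centerRep k := by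
  revert k; decide +kernel

/-- The Delone simplices of `Qc7` up to translations. -/
def deloneSimplex (p : Fin 4 × Equiv.Perm (Fin 7)) (j : Fin 8) : Fin 7 → ℤ :=
  ofCoord (rep p.1 j ∘ p.2)

theorem coordMatrix_mulVec_deloneSimplex (p : Fin 4 × Equiv.Perm (Fin 7)) (j : Fin 8) :
    coordMatrix.mulVec (deloneSimplex p j) = rep p.1 j ∘ p.2 :=
  coordMatrix_mulVec_ofCoord ((isCongr_rep _ _).comp _)

theorem coordMatrix_mulVec_sum_smul_deloneSimplex (p : Fin 4 × Equiv.Perm (Fin 7))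
    (α : Fin 8 → ℤ) :
    coordMatrix.mulVec (∑ j, α j • deloneSimplex p j) = (∑ j, α j • rep p.1 j) ∘ p.2 := by
  rw [Matrix.mulVec_sum]
  simp only [Matrix.mulVec_smul, coordMatrix_mulVec_deloneSimplex]
  ext i
  simp

theorem exists_sum_smul_rep_eq (k : Fin 4) {y : Fin 7 → ℤ} (hy : IsCongr y) :
    ∃ α : Fin 8 → ℤ, ∑ j, α j = 1 ∧ ∑ j, α j • rep k j = y := by
  set n := ofCoord y
  have hn : y = ∑ i, n i • coordMatrix.col i := by
    rw [← coordMatrix_mulVec_ofCoord hy, Matrix.mulVec_eq_sum]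
    simp [n, Matrix.col]
  refine ⟨repCoeff k 0 + ∑ i, n i • repCoeff k i.succ, ?_, ?_⟩
  · simp [Finset.sum_add_distrib, Finset.sum_apply, sum_repCoeff,
      Finset.sum_comm (s := Finset.univ (α := Fin 8)), ← Finset.mul_sum]
  · simp only [Pi.add_apply, add_smul, Finset.sum_add_distrib, sum_repCoeff_zero_smul_rep,
      Finset.sum_apply, Pi.smul_apply, zero_add, Finset.sum_smul, smul_eq_mul, mul_smul]
    rw [Finset.sum_comm, hn]
    refine Finset.sum_congr rfl fun i _ => ?_
    rw [← Finset.smul_sum, sum_repCoeff_succ_smul_rep]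

theorem isUnimodular_deloneSimplex (p : Fin 4 × Equiv.Perm (Fin 7)) :
    IsUnimodular (deloneSimplex p) := by
  intro n
  obtain ⟨α, h1, h2⟩ := exists_sum_smul_rep_eq p.1
    ((isCongr_coordMatrix_mulVec n).comp p.2.symm)
  refine ⟨α, h1, coordMatrix_mulVec_injective ?_⟩
  rw [coordMatrix_mulVec_sum_smul_deloneSimplex, h2]
  ext i
  simp

theorem isBary_apex (p : Fin 4 × Equiv.Perm (Fin 7)) (i : Fin 8) :
    IsBary (deloneSimplex p) (toReal (ofCoord (apexRep p.1 i ∘ p.2)))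
      fun j => (apexCoeff p.1 i j : ℝ) := by
  refine ⟨by beta_reduce; exact_mod_cast sum_apexCoeff p.1 i, ?_⟩
  rw [← toReal_sum_smul]
  congr 1
  apply coordMatrix_mulVec_injective
  rw [coordMatrix_mulVec_sum_smul_deloneSimplex, sum_apexCoeff_smul_rep,
    coordMatrix_mulVec_ofCoord ((isCongr_apexRep _ _).comp _)]

theorem ofCoord_neighbor (p : Fin 4 × Equiv.Perm (Fin 7)) (i m : Fin 8) :
    deloneSimplex (neighborRep p.1 i, neighborPerm p.1 i * p.2) m +
        ofCoord (neighborShift p.1 i ∘ p.2) =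
      ofCoord ((rep (neighborRep p.1 i) m ∘ neighborPerm p.1 i + neighborShift p.1 i) ∘ p.2) :=
  (ofCoord_add ((isCongr_rep _ _).comp _) ((isCongr_neighborShift _ _).comp _)).symm

/-- The Delone triangulation of `Qc7`. -/
def deloneTriangulation : PeriodicTriangulation 7 (Fin 4 × Equiv.Perm (Fin 7)) where
  simplex := deloneSimplex
  unimodular := isUnimodular_deloneSimplex
  apex p i := ofCoord (apexRep p.1 i ∘ p.2)
  apex_neg p i := by
    rw [(isUnimodular_deloneSimplex p).bary_eq (isBary_apex p i)]
    exact Int.cast_lt_zero.2 (apexCoeff_neg p.1 i)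
  neighbor p i := (neighborRep p.1 i, neighborPerm p.1 i * p.2)
  shift p i := ofCoord (neighborShift p.1 i ∘ p.2)
  facet_mem p i j hj := ⟨neighborVertex p.1 i j, by
    rw [ofCoord_neighbor, rep_eq_neighbor _ _ _ hj]
    rfl⟩
  apex_mem p i := ⟨neighborVertex p.1 i i, ofCoord_neighbor p i _⟩

theorem value_Qc7_toReal_sub (m n : Fin 7 → ℤ) :
    value Qc7 (toReal m - toReal n) =
      (permForm (coordMatrix.mulVec m - coordMatrix.mulVec n) : ℤ) / 9 := by
  rw [value_Qc7, Matrix.mulVec_sub, realCoordMatrix_mulVec_toReal, realCoordMatrix_mulVec_toReal,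
    ← toReal_sub, permForm_toReal]

/-- Invariance of `permForm` removes the permutation and leaves 32 integer inequalities. -/
theorem isRegular_deloneTriangulation : deloneTriangulation.IsRegular Qc7 := by
  intro p i
  have h := (isUnimodular_deloneSimplex p).power_eq Qc7 (isBary_apex p i)
  have h2 : ∀ j, value Qc7 (toReal (deloneSimplex p j) -
      toReal (ofCoord (apexRep p.1 i ∘ p.2))) =
      (permForm (rep p.1 j - apexRep p.1 i) : ℤ) / 9 := by
    intro j
    rw [value_Qc7_toReal_sub, coordMatrix_mulVec_deloneSimplex,
      coordMatrix_mulVec_ofCoord ((isCongr_apexRep _ _).comp _),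
      ← permForm_comp (rep p.1 j - apexRep p.1 i) p.2]
    rfl
  have h3 : (∑ j, (apexCoeff p.1 i j : ℝ) * (permForm (rep p.1 j - apexRep p.1 i) : ℤ)) < 0 := by
    exact_mod_cast sum_apexCoeff_mul_permForm_neg p.1 i
  change 0 < power Qc7 (deloneSimplex p) (toReal (ofCoord (apexRep p.1 i ∘ p.2)))
  rw [h]
  simp only [h2, ← mul_div_assoc, ← Finset.sum_div]
  linarith

/-- The scaled circumcentre in permuted coordinates. -/
noncomputable def realCenter (k : Fin 4) : Fin 7 → ℝ := (22⁻¹ : ℝ) • toReal (centerRep k)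

theorem realCoordMatrix_mulVec_inv_mulVec (y : Fin 7 → ℝ) :
    realCoordMatrix.mulVec (realCoordMatrix⁻¹.mulVec y) = y := by
  rw [Matrix.mulVec_mulVec, Matrix.mul_nonsing_inv _ isUnit_det_realCoordMatrix,
    Matrix.one_mulVec]

theorem toReal_deloneSimplex (p : Fin 4 × Equiv.Perm (Fin 7)) (j : Fin 8) :
    toReal (deloneSimplex p j) = realCoordMatrix⁻¹.mulVec (toReal (rep p.1 j) ∘ p.2) := by
  have h : realCoordMatrix.mulVec (toReal (deloneSimplex p j)) = toReal (rep p.1 j) ∘ p.2 := by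
    rw [realCoordMatrix_mulVec_toReal, coordMatrix_mulVec_deloneSimplex]
    rfl
  rw [← h, Matrix.mulVec_mulVec, Matrix.nonsing_inv_mul _ isUnit_det_realCoordMatrix,
    Matrix.one_mulVec]

theorem inhomMin_Qc7_le : inhomMin Qc7 ≤ 15 / 2 := by
  refine deloneTriangulation.inhomMin_le Qc7_mem_pqf isRegular_deloneTriangulation
    (fun p => realCoordMatrix⁻¹.mulVec (realCenter p.1 ∘ p.2))
    (fun p => (permForm (22 • rep p.1 0 - centerRep p.1) : ℤ) / (9 * 22 ^ 2)) ?_ ?_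
  · intro p j
    change value Qc7 (toReal (deloneSimplex p j) - _) = _
    have h : toReal (rep p.1 j) ∘ p.2 - realCenter p.1 ∘ p.2 =
        ((22⁻¹ : ℝ) • toReal (22 • rep p.1 j - centerRep p.1)) ∘ p.2 := by
      ext i
      simp [realCenter, toReal]
      ring
    rw [value_Qc7, toReal_deloneSimplex, ← Matrix.mulVec_sub, realCoordMatrix_mulVec_inv_mulVec,
      h, permForm_comp, ← (permForm_rep_sub_centerRep p.1 j).1, ← permForm_toReal]
    simp only [permForm, Pi.smul_apply, smul_eq_mul, mul_pow, ← Finset.mul_sum]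
    ring
  · intro p
    have : ((permForm (22 • rep p.1 0 - centerRep p.1) : ℤ) : ℝ) ≤ 32670 := by
      exact_mod_cast (permForm_rep_sub_centerRep p.1 0).2
    rw [div_le_iff₀ (by norm_num)]
    linarith

/-! ### A linear lower bound for the inhomogeneous minimum near `Qc7` -/

/-- The matrix of `Q` in the permuted coordinates. -/
noncomputable def permMatrix (Q : quadForms 7) : Matrix (Fin 7) (Fin 7) ℝ :=
  realCoordMatrix⁻¹.transpose * (Q : Matrix (Fin 7) (Fin 7) ℝ) * realCoordMatrix⁻¹

theorem value_inv_mulVec (Q : quadForms 7) (y : Fin 7 → ℝ) :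
    value Q (realCoordMatrix⁻¹.mulVec y) = y ⬝ᵥ (permMatrix Q).mulVec y := by
  rw [value, permMatrix, ← Matrix.mulVec_mulVec, ← Matrix.mulVec_mulVec,
    Matrix.dotProduct_mulVec y, Matrix.vecMul_transpose]

theorem isBary_center (p : Fin 4 × Equiv.Perm (Fin 7)) :
    IsBary (deloneSimplex p) (realCoordMatrix⁻¹.mulVec (realCenter p.1 ∘ p.2))
      fun j => (centerCoeff p.1 j : ℝ) / 22 := by
  constructor
  · have h : ∑ j, (centerCoeff p.1 j : ℝ) = 22 := by exact_mod_cast sum_centerCoeff p.1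
    rw [← Finset.sum_div, h]
    norm_num
  · simp only [toReal_deloneSimplex, ← Matrix.mulVec_smul, ← Matrix.mulVec_sum]
    congr 1
    ext i
    simp only [realCenter, ← sum_centerCoeff_smul_rep, toReal_sum_smul]
    simp only [Finset.sum_apply, Pi.smul_apply, Function.comp_apply, smul_eq_mul, Finset.mul_sum]
    exact Finset.sum_congr rfl fun j _ => by ring

/-- The position of a vertex relative to the circumcentre, scaled by `22`. -/
def offset (k : Fin 4) (j : Fin 8) : Fin 7 → ℤ := 22 • rep k j - centerRep k

theorem sum_value_offset_le_inhomMin {Q : quadForms 7} (hQ : Q ∈ pqf 7)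
    (hreg : deloneTriangulation.IsRegular Q) (k : Fin 4) (σ : Equiv.Perm (Fin 7)) :
    ∑ j, (centerCoeff k j : ℝ) *
      ((toReal (offset k j) ∘ σ) ⬝ᵥ (permMatrix Q).mulVec (toReal (offset k j) ∘ σ)) ≤
      22 ^ 3 * inhomMin Q := by
  have h := deloneTriangulation.sum_mul_value_sub_le_inhomMin hQ hreg (k, σ) (isBary_center (k, σ))
  have h2 : ∀ j, value Q (toReal (deloneSimplex (k, σ) j) -
      realCoordMatrix⁻¹.mulVec (realCenter k ∘ σ)) = 22⁻¹ ^ 2 *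
      ((toReal (offset k j) ∘ σ) ⬝ᵥ (permMatrix Q).mulVec (toReal (offset k j) ∘ σ)) := by
    intro j
    have h3 : toReal (rep k j) ∘ σ - realCenter k ∘ σ =
        (22⁻¹ : ℝ) • (toReal (offset k j) ∘ σ) := by
      ext i
      simp [realCenter, toReal, offset]
      ring
    rw [toReal_deloneSimplex, ← Matrix.mulVec_sub, h3, Matrix.mulVec_smul, value_smul,
      value_inv_mulVec]
  change ∑ j, (centerCoeff k j : ℝ) / 22 * value Q (toReal (deloneSimplex (k, σ) j) -
      realCoordMatrix⁻¹.mulVec (realCenter k ∘ σ)) ≤ inhomMin Q at h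
  simp only [h2] at h
  calc _ = 22 ^ 3 * ∑ j, (centerCoeff k j : ℝ) / 22 * (22⁻¹ ^ 2 *
      ((toReal (offset k j) ∘ σ) ⬝ᵥ (permMatrix Q).mulVec (toReal (offset k j) ∘ σ))) := by
        rw [Finset.mul_sum]
        exact Finset.sum_congr rfl fun j _ => by ring
    _ ≤ _ := by linarith

/-- Sum of the previous bounds over all `7!` permutations; the factor `42 = 7 · 6` clears the
denominators of the average. -/
theorem average_offset_le_inhomMin {Q : quadForms 7} (hQ : Q ∈ pqf 7)
    (hreg : deloneTriangulation.IsRegular Q) (k : Fin 4) :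
    (7 * (∑ j, centerCoeff k j * ∑ i, offset k j i ^ 2 : ℤ) -
        (∑ j, centerCoeff k j * (∑ i, offset k j i) ^ 2 : ℤ)) * (permMatrix Q).trace +
      ((∑ j, centerCoeff k j * (∑ i, offset k j i) ^ 2 : ℤ) -
        (∑ j, centerCoeff k j * ∑ i, offset k j i ^ 2 : ℤ)) * ∑ i, ∑ j, permMatrix Q i j ≤
      42 * (22 ^ 3 * inhomMin Q) := by
  have h := Finset.sum_le_sum fun σ (_ : σ ∈ Finset.univ) =>
    sum_value_offset_le_inhomMin hQ hreg k σ
  rw [Finset.sum_comm, Finset.sum_const, Finset.card_univ, Fintype.card_perm, nsmul_eq_mul] at h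
  simp only [← Finset.mul_sum] at h
  have h2 := fun j => sum_perm_dotProduct_mulVec (permMatrix Q) (toReal (offset k j))
  have hf : (0 : ℝ) < (Fintype.card (Fin 7)).factorial := by positivity
  rw [← mul_le_mul_iff_right₀ hf]
  calc _ = ∑ j, (centerCoeff k j : ℝ) * ((Fintype.card (Fin 7)).factorial *
        ((Fintype.card (Fin 7) * ∑ i, toReal (offset k j) i ^ 2 -
          (∑ i, toReal (offset k j) i) ^ 2) * (permMatrix Q).trace +
        ((∑ i, toReal (offset k j) i) ^ 2 - ∑ i, toReal (offset k j) i ^ 2) *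
          ∑ i, ∑ j, permMatrix Q i j)) := by
        push_cast
        simp only [toReal, Fintype.card_fin, Nat.cast_ofNat]
        rw [Finset.mul_sum, ← Finset.sum_sub_distrib, ← Finset.sum_sub_distrib, Finset.sum_mul,
          Finset.sum_mul, ← Finset.sum_add_distrib, Finset.mul_sum]
        exact Finset.sum_congr rfl fun j _ => by ring
    _ = 42 * ∑ j, (centerCoeff k j : ℝ) * ∑ σ : Equiv.Perm (Fin 7),
        (toReal (offset k j) ∘ σ) ⬝ᵥ (permMatrix Q).mulVec (toReal (offset k j) ∘ σ) := by
        rw [Finset.mul_sum]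
        refine Finset.sum_congr rfl fun j _ => ?_
        rw [← h2, Fintype.card_fin]
        push_cast
        ring
    _ ≤ _ := by linarith

/-- The dual form at which the covering density is stationary. -/
noncomputable def dualMatrix : Matrix (Fin 7) (Fin 7) ℝ :=
  (9 / 11 : ℝ) • 1 + (-(1 / 22) : ℝ) • Matrix.of fun _ _ => (1 : ℝ)

theorem trace_dualMatrix_mul (A : Matrix (Fin 7) (Fin 7) ℝ) :
    (dualMatrix * A).trace = 9 / 11 * A.trace - 1 / 22 * ∑ i, ∑ j, A i j := by
  rw [dualMatrix, Matrix.add_mul, Matrix.trace_add, Matrix.smul_mul, Matrix.smul_mul,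
    Matrix.one_mul, Matrix.trace_smul, Matrix.trace_smul]
  have h : ((Matrix.of fun _ _ => (1 : ℝ)) * A).trace = ∑ i, ∑ j, A i j := by
    simp only [Matrix.trace, Matrix.diag_apply, Matrix.mul_apply, Matrix.of_apply, one_mul]
    exact Finset.sum_comm
  rw [h]
  simp only [smul_eq_mul]
  ring

theorem trace_dualMatrix_mul_le_inhomMin {Q : quadForms 7} (hQ : Q ∈ pqf 7)
    (hreg : deloneTriangulation.IsRegular Q) :
    15 / 14 * (dualMatrix * permMatrix Q).trace ≤ inhomMin Q := by
  -- Classes 0 and 3 are those whose squared circumradius for `Qc7` attains 15/2.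
  have h0 := average_offset_le_inhomMin hQ hreg 0
  have h3 := average_offset_le_inhomMin hQ hreg 3
  rw [show ∑ j, centerCoeff 0 j * ∑ i, offset 0 j i ^ 2 = 63162 by decide +kernel,
    show ∑ j, centerCoeff 0 j * (∑ i, offset 0 j i) ^ 2 = 23958 by decide +kernel] at h0
  rw [show ∑ j, centerCoeff 3 j * ∑ i, offset 3 j i ^ 2 = 61226 by decide +kernel,
    show ∑ j, centerCoeff 3 j * (∑ i, offset 3 j i) ^ 2 = 45254 by decide +kernel] at h3
  rw [trace_dualMatrix_mul]
  push_cast at h0 h3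
  -- The convex combination with weights 1/4 and 3/4 of `h0` and `h3` is proportional to the dual
  -- form.
  linarith

theorem posSemidef_dualMatrix : dualMatrix.PosSemidef := by
  refine Matrix.posSemidef_iff_dotProduct_mulVec.2 ⟨?_, fun x => ?_⟩
  · ext i j
    simp [dualMatrix, Matrix.one_apply, eq_comm]
  · have h : star x ⬝ᵥ dualMatrix.mulVec x = 9 / 11 * ∑ i, x i ^ 2 - 1 / 22 * (∑ i, x i) ^ 2 := by
      simp [dualMatrix, Matrix.mulVec, dotProduct, Fin.sum_univ_succ]
      ring
    have h2 : (∑ i, x i) ^ 2 ≤ 7 * ∑ i, x i ^ 2 := by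
      simpa using sq_sum_le_card_mul_sum_sq (s := Finset.univ) (f := x)
    have h3 : 0 ≤ ∑ i, x i ^ 2 := Finset.sum_nonneg fun i _ => sq_nonneg _
    rw [h]
    linarith

theorem posSemidef_permMatrix {Q : quadForms 7} (hQ : Q ∈ pqf 7) :
    (permMatrix Q).PosSemidef := by
  have := (show Matrix.PosDef _ from hQ).posSemidef.conjTranspose_mul_mul_same realCoordMatrix⁻¹
  rwa [Matrix.conjTranspose_eq_transpose_of_trivial] at this

theorem det_permMatrix (Q : quadForms 7) : (permMatrix Q).det = det Q / 3 ^ 12 := by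
  rw [permMatrix, Matrix.det_mul, Matrix.det_mul, Matrix.det_transpose, Matrix.det_nonsing_inv,
    det_realCoordMatrix, det, Ring.inverse_eq_inv']
  ring

theorem det_dualMatrix : dualMatrix.det = 9 ^ 7 / (11 ^ 6 * 18) := by
  rw [dualMatrix, det_smul_one_add_smul_ones _ _ (by norm_num)]
  norm_num

theorem permMatrix_Qc7 : permMatrix Qc7 =
    (11 / 9 : ℝ) • 1 + (1 / 9 : ℝ) • Matrix.of fun _ _ => (1 : ℝ) := by
  have h : (Qc7 : Matrix (Fin 7) (Fin 7) ℝ) = realCoordMatrix.transpose *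
      ((11 / 9 : ℝ) • 1 + (1 / 9 : ℝ) • Matrix.of fun _ _ => (1 : ℝ)) * realCoordMatrix := by
    ext i j
    fin_cases i <;> fin_cases j <;>
      simp [Qc7, realCoordMatrix, coordMatrix, Matrix.mul_apply, Fin.sum_univ_succ,
        Matrix.one_apply] <;> norm_num
  rw [permMatrix, h, ← Matrix.mul_assoc, ← Matrix.mul_assoc, ← Matrix.transpose_mul,
    Matrix.mul_nonsing_inv _ isUnit_det_realCoordMatrix, Matrix.transpose_one, Matrix.one_mul,
    Matrix.mul_assoc, Matrix.mul_nonsing_inv _ isUnit_det_realCoordMatrix, Matrix.mul_one]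

theorem det_Qc7 : det Qc7 = 2 * 11 ^ 6 := by
  have h := det_permMatrix Qc7
  rw [permMatrix_Qc7, det_smul_one_add_smul_ones _ _ (by norm_num)] at h
  norm_num at h
  linarith

/-- For the lower bound, `dualMatrix` is the inverse of `permMatrix Qc7`, so the trace is 7 and the
linear bound is sharp. -/
theorem inhomMin_Qc7 : inhomMin Qc7 = 15 / 2 := by
  refine le_antisymm inhomMin_Qc7_le ?_
  have h := trace_dualMatrix_mul_le_inhomMin Qc7_mem_pqf isRegular_deloneTriangulation
  rw [trace_dualMatrix_mul, permMatrix_Qc7] at h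
  simp [Matrix.trace, Matrix.one_apply, Finset.sum_add_distrib] at h
  linarith

theorem det_pos {d : ℕ} {Q : quadForms d} (hQ : Q ∈ pqf d) : 0 < det Q :=
  (show Matrix.PosDef _ from hQ).det_pos

theorem coveringDensity_Qc7_le {Q : quadForms 7} (hQ : Q ∈ pqf 7)
    (hreg : deloneTriangulation.IsRegular Q) : coveringDensity Qc7 ≤ coveringDensity Q := by
  refine mul_le_mul_of_nonneg_right (Real.sqrt_le_sqrt ?_) ENNReal.toReal_nonneg
  have h1 := trace_dualMatrix_mul_le_inhomMin hQ hreg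
  have h2 := det_mul_det_le_trace_mul_div_card_pow (posSemidef_permMatrix hQ)
    posSemidef_dualMatrix
  have hd := det_pos hQ
  rw [det_dualMatrix, det_permMatrix, Fintype.card_fin] at h2
  -- The linear bound divided by 15/2; an odd power is monotone, so no sign condition is needed.
  have h3 : ((dualMatrix * permMatrix Q).trace / (7 : ℕ)) ^ 7 ≤ (inhomMin Q * (2 / 15)) ^ 7 := by
    refine Odd.pow_le_pow (by decide) |>.2 ?_
    push_cast
    linarith
  -- With the determinants inserted, AM-GM reads `det Q / (2 · 11^6) ≤ (2 μ(Q) / 15)^7`.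
  rw [inhomMin_Qc7, det_Qc7, le_div_iff₀ hd]
  have h4 := h2.trans h3
  rw [mul_pow] at h4
  linarith

theorem isLocallyOptimalCovering_Qc7 : IsLocallyOptimalCovering Qc7 := by
  refine ⟨Qc7_mem_pqf, ?_⟩
  have h := deloneTriangulation.eventually_isRegular isRegular_deloneTriangulation
  filter_upwards [nhdsWithin_le_nhds h, self_mem_nhdsWithin] with Q hreg hQ
  exact coveringDensity_Qc7_le hQ hreg

/-! ### Numerical values -/

theorem unitBallVolume_seven : unitBallVolume 7 = 16 * Real.pi ^ 3 / 105 := by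
  rw [unitBallVolume, InnerProductSpace.volume_closedBall_of_dim_odd (k := 3) (by simp)]
  rw [ENNReal.ofReal_one, one_pow, one_mul, ENNReal.toReal_ofReal (by positivity)]
  norm_num [Nat.doubleFactorial]
  ring

theorem coveringDensity_Qc7_bounds :
    2.900024 < coveringDensity Qc7 ∧ coveringDensity Qc7 < 2.900025 := by
  rw [coveringDensity, inhomMin_Qc7, det_Qc7, unitBallVolume_seven]
  have h1 := Real.pi_gt_d20
  have h2 := Real.pi_lt_d20
  have h3 : 0.61379220 < √((15 / 2 : ℝ) ^ 7 / (2 * 11 ^ 6)) :=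
    Real.lt_sqrt_of_sq_lt (by norm_num)
  have h4 : √((15 / 2 : ℝ) ^ 7 / (2 * 11 ^ 6)) < 0.61379221 :=
    (Real.sqrt_lt' (by norm_num)).2 (by norm_num)
  have h5 : (3.14159265358979 : ℝ) ^ 3 < Real.pi ^ 3 :=
    pow_lt_pow_left₀ (by linarith) (by norm_num) (by norm_num)
  have h6 : Real.pi ^ 3 < (3.14159265358980 : ℝ) ^ 3 :=
    pow_lt_pow_left₀ (by linarith) Real.pi_pos.le (by norm_num)
  constructor
  · calc (2.900024 : ℝ) < 0.61379220 * (16 * 3.14159265358979 ^ 3 / 105) := by norm_num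
      _ < _ := mul_lt_mul'' h3 (by linarith) (by norm_num) (by norm_num)
  · calc _ < 0.61379221 * (16 * (3.14159265358980 : ℝ) ^ 3 / 105) :=
          mul_lt_mul'' h4 (by linarith) (Real.sqrt_nonneg _) (by positivity)
      _ < _ := by norm_num

/-! ### The principal form -/

theorem value_principalForm (x : Fin 7 → ℝ) :
    value (principalForm 7) x = 8 * ∑ i, x i ^ 2 - (∑ i, x i) ^ 2 := by
  simp [value, principalForm, Matrix.mulVec, dotProduct, Fin.sum_univ_succ]
  ring

theorem principalForm_mem_pqf : principalForm 7 ∈ pqf 7 := by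
  refine mem_pqf_iff.2 fun x hx => ?_
  obtain ⟨i, hi⟩ := Function.ne_iff.1 hx
  have h : 0 < ∑ i, x i ^ 2 :=
    Finset.sum_pos' (fun i _ => sq_nonneg _) ⟨i, Finset.mem_univ i, by
      have : x i ≠ 0 := hi
      positivity⟩
  have h2 : (∑ i, x i) ^ 2 ≤ 7 * ∑ i, x i ^ 2 := by
    simpa using sq_sum_le_card_mul_sum_sq (s := Finset.univ) (f := x)
  rw [value_principalForm]
  linarith

theorem det_principalForm : det (principalForm 7) = 8 ^ 6 := by
  have h : (principalForm 7 : Matrix (Fin 7) (Fin 7) ℝ) =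
      (8 : ℝ) • 1 + (-1 : ℝ) • Matrix.of fun _ _ => (1 : ℝ) := by
    ext i j
    by_cases hij : i = j <;> simp [principalForm, hij]
    norm_num
  rw [det, h, det_smul_one_add_smul_ones _ _ (by norm_num)]
  norm_num

/-- Termwise comparison `w ≤ w ^ 2` over all differences of the coordinates and zero. -/
theorem sum_weight_mul_le (v : Fin 7 → ℤ) :
    ∑ i : Fin 7, (2 * (i : ℤ) - 5) * v i ≤ 8 * ∑ i, v i ^ 2 - (∑ i, v i) ^ 2 := by
  have h : ∀ w : ℤ, w ≤ w ^ 2 := Int.le_self_sq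
  have h0 : ∑ i, v i ≤ ∑ i, v i ^ 2 := Finset.sum_le_sum fun i _ => h (v i)
  have h1 : ∑ j, ∑ i, (if i < j then v j - v i else 0) ≤
      ∑ j, ∑ i, if i < j then (v j - v i) ^ 2 else 0 :=
    Finset.sum_le_sum fun j _ => Finset.sum_le_sum fun i _ => by
      split_ifs
      · exact h _
      · exact le_rfl
  -- `h0 + h1` is the claim: `v i` has weight `1 + i - (6 - i)`, and `8 ∑ v_i² - (∑ v_i)²` is the
  -- sum of all `v_i²` and `(v_j - v_i)²`.
  simp [Fin.sum_univ_succ] at h0 h1 ⊢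
  linarith

theorem le_inhomMin_principalForm : 21 / 4 ≤ inhomMin (principalForm 7) := by
  -- The point `(1, ..., 7)/8` has value 21/4, and its cross term with `v` is the linear form of
  -- `sum_weight_mul_le`.
  refine le_inhomMin principalForm_mem_pqf (fun i => ((i : ℕ) + 1) / 8) fun v => ?_
  have h : ((∑ i : Fin 7, (2 * (i : ℤ) - 5) * v i : ℤ) : ℝ) ≤
      ((8 * ∑ i, v i ^ 2 - (∑ i, v i) ^ 2 : ℤ) : ℝ) := by
    exact_mod_cast sum_weight_mul_le v
  rw [value_principalForm]
  simp [Fin.sum_univ_succ, toReal] at h ⊢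
  linarith

theorem coveringDensity_Qc7_lt : coveringDensity Qc7 < coveringDensity (principalForm 7) := by
  have hv : 0 < unitBallVolume 7 := by
    rw [unitBallVolume_seven]
    positivity
  refine mul_lt_mul_of_pos_right (Real.sqrt_lt_sqrt (by rw [inhomMin_Qc7, det_Qc7]; positivity) ?_)
    hv
  rw [inhomMin_Qc7, det_Qc7, det_principalForm]
  calc (15 / 2 : ℝ) ^ 7 / (2 * 11 ^ 6) < (21 / 4) ^ 7 / 8 ^ 6 := by norm_num
    _ ≤ _ := by
      have := pow_le_pow_left₀ (by norm_num) le_inhomMin_principalForm 7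
      gcongr

end LatticeCovering

theorem mainTheorem5 :
    LatticeCovering.Qc7 ∈ LatticeCovering.pqf 7 ∧
    LatticeCovering.Qc7 ∈
      interior (LatticeCovering.secondaryCone
        (LatticeCovering.deloneSubdivision LatticeCovering.Qc7)) ∧
    LatticeCovering.IsLocallyOptimalCovering LatticeCovering.Qc7 ∧
    LatticeCovering.inhomMin LatticeCovering.Qc7 = 15 / 2 ∧
    LatticeCovering.det LatticeCovering.Qc7 = 2 * 11 ^ 6 ∧
    2.900024 < LatticeCovering.coveringDensity LatticeCovering.Qc7 ∧
    LatticeCovering.coveringDensity LatticeCovering.Qc7 < 2.900025 ∧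
    LatticeCovering.coveringDensity LatticeCovering.Qc7 <
      LatticeCovering.coveringDensity (LatticeCovering.principalForm 7) :=
  ⟨LatticeCovering.Qc7_mem_pqf,
    LatticeCovering.deloneTriangulation.mem_interior_secondaryCone LatticeCovering.Qc7_mem_pqf
      LatticeCovering.isRegular_deloneTriangulation,
    LatticeCovering.isLocallyOptimalCovering_Qc7, LatticeCovering.inhomMin_Qc7,
    LatticeCovering.det_Qc7, LatticeCovering.coveringDensity_Qc7_bounds.1,
    LatticeCovering.coveringDensity_Qc7_bounds.2, LatticeCovering.coveringDensity_Qc7_lt⟩
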